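/- Let $G$ be a locally compact metrisable group with Borel $\sigma$-algebra $\mathcal B(G)$, let $\mathcal H_{\mathcal S},\mathcal H_{\mathcal R}$ be separable complex Hilbert spaces (of finite or infinite dimension) carrying strongly continuous unitary representations $U_{\mathcal S},U_{\mathcal R}$ of $G$, and put $\mathcal H_{\mathcal T}=\mathcal H_{\mathcal S}\otimes\mathcal H_{\mathcal R}$ (Hilbert space tensor product). For a Hilbert space $\mathcal H$, $\mathcal L(\mathcal H)$ denotes the bounded operators and $\mathcal L_1(\mathcal H)$ the trace class operators. A POM on a measurable space $\Omega$ acting in $\mathcal H$ is a map $\mathsf E$ from the measurable subsets of $\Omega$ to the positive operators on $\mathcal H$ with $\mathsf E(\Omega)=1$ that is $\sigma$-additive in the weak sense; an effect is an operator $E$ with $0\le E\le 1$. Let $\mathsf F:\mathcal B(G)\to\mathcal L(\mathcal H_{\mathcal R})$ be a covariant POM, i.e. $\mathsf F(gX)=U_{\mathcal R}(g)\mathsf F(X)U_{\mathcal R}(g)^*$ for $g\in G$, $X\in\mathcal B(G)$. Write $\alpha_g(A)=U_{\mathcal S}(g)AU_{\mathcal S}(g)^*$. (0) (The map is well defined.)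 (a) For every $A\in\mathcal L(\mathcal H_{\mathcal S})$ there is a unique $B\in\mathcal L(\mathcal H_{\mathcal T})$ such that for all $\varphi,\varphi'\in\mathcal H_{\mathcal S}$, $\eta\in\mathcal H_{\mathcal R}$ $$\langle\varphi\otimes\eta\,|\,B(\varphi'\otimes\eta)\rangle=\int_G\langle\varphi\,|\,\alpha_g(A)\varphi'\rangle\,\langle\eta\,|\,\mathsf F(dg)\eta\rangle .$$ This $B$ is denoted $¥(A)=\int_G U_{\mathcal S}(g)AU_{\mathcal S}(g)^*\otimes\mathsf F(dg)$. (b) Let $g\mapsto\alpha_g(A)$ be norm continuous. Call a countable Borel partition $(V_n)$ of $G$ a mesh of width $\epsilon$ for $A$ if $\|\alpha_g(A)-\alpha_{g'}(A)\|\le\epsilon\|A\|$ whenever $g,g'$ lie in the same $V_n$. If $G$ is second countable, there is a mesh of width $\epsilon$ for every $\epsilon>0$. If $\epsilon_N\to0$, $(V^N_n)_n$ is a mesh of width $\epsilon_N$ and $g^N_n\in V^N_n$, then the Riemann sums $\sum_n\alpha_{g^N_n}(A)\otimes\mathsf F(V^N_n)$ converge weakly to bounded operators $¥_N(A)$, and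 $\|¥_N(A)-¥(A)\|\to0$. (c) Every $A\in\mathcal L(\mathcal H_{\mathcal S})$ is the weak limit of a sequence $(A_n)$ with $\|A_n\|\le\|A\|$ and $g\mapsto\alpha_g(A_n)$ norm continuous. Whenever a norm-bounded sequence $(A_n)$ converges weakly to $A$, then $\langle\Phi|¥(A_n)\Psi\rangle\to\langle\Phi|¥(A)\Psi\rangle$ for all $\Phi,\Psi\in\mathcal H_{\mathcal T}$. (d) If $G$ is compact, $\mathcal H_{\mathcal R}$ is finite dimensional, $\mu$ is a Haar measure, and $\mathsf F(X)=\kappa\int_XU_{\mathcal R}(g)TU_{\mathcal R}(g)^*\,d\mu(g)$ for all $X\in\mathcal B(G)$ with some $\kappa\in\mathbb R$ and positive $T$, then (weakly) $¥(A)=\kappa\int_GU_{\mathcal S}(g)AU_{\mathcal S}(g)^*\otimes U_{\mathcal R}(g)TU_{\mathcal R}(g)^*\,d\mu(g)$. The map $¥:\mathcal L(\mathcal H_{\mathcal S})\to\mathcal L(\mathcal H_{\mathcal T})$ has the following properties. (1) $¥$ is linear, $¥(1)=1$, and $¥(A^*)=¥(A)^*$. (2) $¥$ is positive and bounded, with $\|¥(A)\|\le\|A\|$.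 (3) $¥$ is completely positive. (4) There is a linear map $¥_*:\mathcal L_1(\mathcal H_{\mathcal T})\to\mathcal L_1(\mathcal H_{\mathcal S})$, bounded in trace norm, with $\operatorname{tr}[R\,¥(A)]=\operatorname{tr}[¥_*(R)A]$ for all $A\in\mathcal L(\mathcal H_{\mathcal S})$, $R\in\mathcal L_1(\mathcal H_{\mathcal T})$, and it is determined by this equation. Moreover $¥$ is normal: if an increasing net $(A_\alpha)$ has supremum $A$, then $(¥(A_\alpha))$ has supremum $¥(A)$. (5) If $E$ is an effect, so is $¥(E)$. If $\mathsf E$ is a POM on a measurable space $\Omega$ (in particular on $(G,\mathcal B(G))$) acting in $\mathcal H_{\mathcal S}$, then $X\mapsto¥(\mathsf E(X))$ is a POM acting in $\mathcal H_{\mathcal T}$. (6) If $\mathsf F$ is projection valued, then $¥(AB)=¥(A)¥(B)$ for all $A,B$, so that $¥$ is a unital $*$-homomorphism. (7) With $\mathcal U(g)=U_{\mathcal S}(g)\otimes U_{\mathcal R}(g)$ one has $\mathcal U(g)¥(A)\mathcal U(g)^*=¥(A)$ for all $A$ and $g$. If $\alpha_g(A)=A$ for all $g\in G$, then $¥(A)=A\otimes1$.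 -/

import Mathlib

open MeasureTheory Filter Topology TensorProduct
open scoped ComplexInnerProductSpace

noncomputable section

/-! ### Positive operator valued measures -/

/-- A normalised positive operator valued measure on the measurable space `Ω`, acting in `H`.
The order on `H →L[ℂ] H` is the usual operator order; the values on non-measurable sets carry no
meaning and are never used. -/
structure POM (Ω : Type*) [MeasurableSpace Ω] (H : Type*) [NormedAddCommGroup H]
    [InnerProductSpace ℂ H] where
  toFun : Set Ω → H →L[ℂ] H
  univ' : toFun Set.univ = 1
  nonneg' : ∀ X, MeasurableSet X → 0 ≤ toFun X
  /-- `σ`-additivity, with the sum converging weakly -/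
  hasSum' : ∀ X : ℕ → Set Ω, (∀ i, MeasurableSet (X i)) → Pairwise (fun i j => Disjoint (X i) (X j)) →
    ∀ x y : H, HasSum (fun i => ⟪x, toFun (X i) y⟫) ⟪x, toFun (⋃ i, X i) y⟫

namespace POM

variable {Ω H : Type*} [MeasurableSpace Ω] [NormedAddCommGroup H] [InnerProductSpace ℂ H]

instance : CoeFun (POM Ω H) (fun _ => Set Ω → H →L[ℂ] H) := ⟨POM.toFun⟩

theorem inner_empty (F : POM Ω H) (x y : H) : ⟪x, F ∅ y⟫ = 0 := by
  have h := F.hasSum' (fun _ => ∅) (fun _ => MeasurableSet.empty)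
    (fun _ _ _ => disjoint_bot_left) x y
  exact tendsto_nhds_unique tendsto_const_nhds h.summable.tendsto_atTop_zero

/-- The finite positive measure `X ↦ ⟨η, F(X) η⟩`. -/
def measure (F : POM Ω H) (η : H) : Measure Ω :=
  Measure.ofMeasurable (fun X _ => ENNReal.ofReal (⟪η, F X η⟫).re)
    (by simp [F.inner_empty])
    (by
      intro X hX hd
      have h := F.hasSum' X hX hd η η
      have hre := Complex.hasSum_re h
      rw [← hre.tsum_eq]
      refine ENNReal.ofReal_tsum_of_nonneg (fun i => ?_) hre.summable
      have hp := (ContinuousLinearMap.nonneg_iff_isPositive _).mp (F.nonneg' (X i) (hX i))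
      simpa using hp.re_inner_nonneg_right η)

/-- `F` is projection valued: all its effects are idempotent (they are self-adjoint, being
positive). -/
def IsProjectionValued (F : POM Ω H) : Prop :=
  ∀ X, MeasurableSet X → F X * F X = F X

end POM

/-! ### Hilbert space tensor product -/

/-- The Hilbert space tensor product: the completion of the algebraic one. -/
abbrev HilbertTensor (H K : Type*) [NormedAddCommGroup H] [InnerProductSpace ℂ H]
    [NormedAddCommGroup K] [InnerProductSpace ℂ K] : Type _ :=
  UniformSpace.Completion (H ⊗[ℂ] K)

section Tensor

variable {H K : Type*} [NormedAddCommGroup H] [InnerProductSpace ℂ H]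
  [NormedAddCommGroup K] [InnerProductSpace ℂ K]

/-- The elementary tensor `φ ⊗ η`. -/
def tens (φ : H) (η : K) : HilbertTensor H K :=
  ((φ ⊗ₜ[ℂ] η : H ⊗[ℂ] K) : UniformSpace.Completion (H ⊗[ℂ] K))

/-- The bounded operator `A ⊗ B`. -/
def opTens (A : H →L[ℂ] H) (B : K →L[ℂ] K) : HilbertTensor H K →L[ℂ] HilbertTensor H K :=
  (TensorProduct.mapL A B).completion

theorem opTens_tens (A : H →L[ℂ] H) (B : K →L[ℂ] K) (φ : H) (η : K) :
    opTens A B (tens φ η) = tens (A φ) (B η) := by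
  simp [opTens, tens]

end Tensor

/-! ### Trace class operators -/

section Trace

variable (H : Type*) [NormedAddCommGroup H] [InnerProductSpace ℂ H] [CompleteSpace H]

/-- The index set of a fixed orthonormal (Hilbert) basis of `H`. -/
def stdIndex : Set H := (exists_hilbertBasis ℂ H).choose

/-- A fixed orthonormal (Hilbert) basis of `H`; the notions below do not depend on it. -/
def stdBasis : HilbertBasis (stdIndex H) ℂ H := (exists_hilbertBasis ℂ H).choose_spec.choose

variable {H}

/-- `T` is of trace class: `∑ᵢ ⟨eᵢ, |T| eᵢ⟩ < ∞`, where `|T| = (T* T)^(1/2)`. -/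
def IsTraceClass (T : H →L[ℂ] H) : Prop :=
  Summable fun i => (⟪stdBasis H i, CFC.abs T (stdBasis H i)⟫).re

/-- The trace norm `‖T‖₁ = ∑ᵢ ⟨eᵢ, |T| eᵢ⟩` of a trace class operator. -/
def traceNorm (T : H →L[ℂ] H) : ℝ :=
  ∑' i, (⟪stdBasis H i, CFC.abs T (stdBasis H i)⟫).re

/-- The trace `∑ᵢ ⟨eᵢ, T eᵢ⟩` of a trace class operator. -/
def opTrace (T : H →L[ℂ] H) : ℂ :=
  ∑' i, ⟪stdBasis H i, T (stdBasis H i)⟫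

end Trace

/-- A positive map between algebras of bounded operators is normal if it preserves suprema of
increasing nets (equivalently, of non-empty upward directed sets). -/
def IsNormalMap {H K : Type*} [NormedAddCommGroup H] [InnerProductSpace ℂ H]
    [NormedAddCommGroup K] [InnerProductSpace ℂ K]
    (Φ : (H →L[ℂ] H) → (K →L[ℂ] K)) : Prop :=
  ∀ (D : Set (H →L[ℂ] H)) (A : H →L[ℂ] H), D.Nonempty → DirectedOn (· ≤ ·) D →
    IsLUB D A → IsLUB (Φ '' D) (Φ A)

/-! ### Relativisation -/

section Relativisation

/-- `α_g(A) = U(g) A U(g)*`. -/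
def conjAct {G H : Type*} [Group G] [NormedAddCommGroup H] [InnerProductSpace ℂ H]
    [CompleteSpace H] (U : G →* unitary (H →L[ℂ] H)) (g : G) (A : H →L[ℂ] H) : H →L[ℂ] H :=
  (U g : H →L[ℂ] H) * A * star (U g : H →L[ℂ] H)

/-- `F` is a covariant POM on `G`: `F(g X) = U(g) F(X) U(g)*`. -/
def IsCovariant {G H : Type*} [Group G] [MeasurableSpace G] [NormedAddCommGroup H]
    [InnerProductSpace ℂ H] [CompleteSpace H] (U : G →* unitary (H →L[ℂ] H)) (F : POM G H) : Prop :=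
  ∀ (g : G) (X : Set G), MeasurableSet X → F ((fun h => g * h) '' X) = conjAct U g (F X)

variable {G : Type*} [Group G] [MeasurableSpace G]
  {HS HR : Type*} [NormedAddCommGroup HS] [InnerProductSpace ℂ HS] [CompleteSpace HS]
  [NormedAddCommGroup HR] [InnerProductSpace ℂ HR]

/-- `B = ∫ U(g) A U(g)* ⊗ F(dg)` as a weak integral: for all `φ, φ'` and `η`,
`⟨φ ⊗ η, B (φ' ⊗ η)⟩ = ∫ ⟨φ, U(g) A U(g)* φ'⟩ ⟨η, F(dg) η⟩`.
By polarisation in `η` this fixes all matrix elements of `B` between elementary tensors. -/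
def IsRelativisation (U : G →* unitary (HS →L[ℂ] HS)) (F : POM G HR) (A : HS →L[ℂ] HS)
    (B : HilbertTensor HS HR →L[ℂ] HilbertTensor HS HR) : Prop :=
  ∀ (φ φ' : HS) (η : HR),
    ⟪tens φ η, B (tens φ' η)⟫ = ∫ g, ⟪φ, conjAct U g A φ'⟫ ∂(F.measure η)

open Classical in
/-- The relativisation map `A ↦ ∫ U(g) A U(g)* ⊗ F(dg)` (with the value `0` should the weak
integral not exist as a bounded operator). -/
def relativise (U : G →* unitary (HS →L[ℂ] HS)) (F : POM G HR) (A : HS →L[ℂ] HS) :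
    HilbertTensor HS HR →L[ℂ] HilbertTensor HS HR :=
  if h : ∃ B, IsRelativisation U F A B then h.choose else 0

/-- A mesh of width `ε` for `A`: a countable Borel partition of `G` (some cells may be empty) with
`‖α_g(A) - α_g'(A)‖ ≤ ε ‖A‖` for `g, g'` in the same cell. -/
structure IsMesh (U : G →* unitary (HS →L[ℂ] HS)) (A : HS →L[ℂ] HS) (ε : ℝ)
    (V : ℕ → Set G) : Prop where
  measurable : ∀ n, MeasurableSet (V n)
  disjoint : Pairwise fun m n => Disjoint (V m) (V n)
  cover : ⋃ n, V n = Set.univ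
  width : ∀ n, ∀ g ∈ V n, ∀ g' ∈ V n, ‖conjAct U g A - conjAct U g' A‖ ≤ ε * ‖A‖

/-- `S` is the Riemann sum `∑ₙ α_{gₙ}(A) ⊗ F(Vₙ)` (converging weakly) for the cells `Vₙ` and the
points `gₙ`. -/
def IsRiemannSum (U : G →* unitary (HS →L[ℂ] HS)) (F : POM G HR) (A : HS →L[ℂ] HS)
    (V : ℕ → Set G) (p : ℕ → G) (S : HilbertTensor HS HR →L[ℂ] HilbertTensor HS HR) : Prop :=
  ∀ Φ Ψ : HilbertTensor HS HR,
    HasSum (fun n => ⟪Φ, opTens (conjAct U (p n) A) (F (V n)) Ψ⟫) ⟪Φ, S Ψ⟫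

end Relativisation

end

/-! ### Weak limits of operators -/

section WeakLimits

variable {H : Type*} [NormedAddCommGroup H] [InnerProductSpace ℂ H]

/-! The relativisation is the case a(g) = α_g(A) of a weak integral ∫ a(ω) ⊗ F(dω), with a norm
bounded and weakly measurable. Scalar integrals prescribe its matrix elements between elementary
tensors, and by polarisation at most one operator has them; the point is that a bounded one exists.
Splitting each positive D as √D √D and applying Cauchy–Schwarz gives ∑ |⟨x, (Aᵢ ⊗ Dᵢ) y⟩| ≤ C ‖x‖
‖y‖ when ‖Aᵢ‖ ≤ C and ∑ Dᵢ ≤ 1 (`sum_norm_inner_opTens_le`). So the Riemann sums over finite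
measurable partitions are bounded by any bound of a. Bounded sets are weakly compact, and the limit
has the right matrix elements, so the sums converge weakly (`tendsto_riemannSum`). The norm bound
and (complete) positivity pass from Riemann sums to the limit; linearity and adjoints follow from
uniqueness, invariance from a translation of the integration variable.

Scalar dominated convergence together with the norm bound lets bounded pointwise weak limits of
sequences pass through the integral (`tendsto_weakIntegral`). This yields σ-additivity of
relativised POMs, the countable Riemann sums of a mesh, and the extension from finite rank
operators, whose orbits are norm continuous. If F is projection valued, disjoint sets have
orthogonal projections, so the integral is multiplicative when the left factor is a simple function;
approximation of the left factor alone gives the general case.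

For the predual, A ↦ tr[R ¥(A)] restricted to rank one operators is a bounded sesquilinear form,
hence an operator T (`exists_predual_apply`). Boundedness of the functional makes T trace class, and
approximation by finite rank operators extends the trace identity to all A. Normality then follows,
because the trace against a fixed trace class operator is continuous along bounded weakly convergent
nets. -/

theorem ContinuousLinearMap.ext_inner_map {A B : H →L[ℂ] H} (h : ∀ x y, ⟪x, A y⟫ = ⟪x, B y⟫) :
    A = B :=
  ContinuousLinearMap.ext fun y => ext_inner_left ℂ fun x => h x y

theorem norm_inner_apply_le (A : H →L[ℂ] H) (x y : H) : ‖⟪x, A y⟫‖ ≤ ‖A‖ * ‖x‖ * ‖y‖ :=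
  calc ‖⟪x, A y⟫‖ ≤ ‖x‖ * ‖A y‖ := norm_inner_le_norm _ _
    _ ≤ ‖x‖ * (‖A‖ * ‖y‖) := by gcongr; exact A.le_opNorm y
    _ = ‖A‖ * ‖x‖ * ‖y‖ := by ring

theorem norm_inner_apply_le_of_le {A : H →L[ℂ] H} {C : ℝ} (hA : ‖A‖ ≤ C) (x y : H) :
    ‖⟪x, A y⟫‖ ≤ C * ‖x‖ * ‖y‖ :=
  (norm_inner_apply_le A x y).trans (by gcongr)

theorem ContinuousLinearMap.opNorm_le_of_inner {A : H →L[ℂ] H} {C : ℝ} (hC : 0 ≤ C)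
    (h : ∀ x y, ‖⟪x, A y⟫‖ ≤ C * ‖x‖ * ‖y‖) : ‖A‖ ≤ C := by
  refine A.opNorm_le_bound hC fun y => ?_
  have h1 := h (A y) y
  rw [inner_self_eq_norm_sq_to_K] at h1
  simp only [norm_pow, RCLike.norm_ofReal, abs_norm] at h1
  rcases eq_or_ne ‖A y‖ 0 with h0 | h0
  · rw [h0]; positivity
  · have : 0 < ‖A y‖ := lt_of_le_of_ne (norm_nonneg _) (Ne.symm h0)
    nlinarith

theorem ContinuousLinearMap.nonneg_iff_inner {A : H →L[ℂ] H} :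
    0 ≤ A ↔ ∀ x, 0 ≤ (⟪x, A x⟫).re ∧ (⟪x, A x⟫).im = 0 := by
  rw [ContinuousLinearMap.nonneg_iff_isPositive, ContinuousLinearMap.isPositive_iff_complex]
  refine forall_congr' fun x => ?_
  rw [← inner_conj_symm (A x) x]
  simp only [RCLike.re_to_complex, Complex.conj_re, Complex.ext_iff, Complex.ofReal_re,
    Complex.ofReal_im, Complex.conj_im, true_and]
  constructor
  · rintro ⟨h1, h2⟩; exact ⟨h2, by linarith⟩
  · rintro ⟨h1, h2⟩; exact ⟨by linarith, h1⟩

theorem ContinuousLinearMap.nonneg_of_tendsto {ι : Type*} {l : Filter ι} [l.NeBot]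
    {S : ι → H →L[ℂ] H} {A : H →L[ℂ] H} (hS : ∀ᶠ i in l, 0 ≤ S i)
    (h : ∀ x, Tendsto (fun i => ⟪x, S i x⟫) l (𝓝 ⟪x, A x⟫)) : 0 ≤ A := by
  rw [ContinuousLinearMap.nonneg_iff_inner]
  intro x
  have h1 := (Complex.continuous_re.tendsto _).comp (h x)
  have h2 := (Complex.continuous_im.tendsto _).comp (h x)
  refine ⟨ge_of_tendsto h1 ?_, tendsto_nhds_unique h2 (tendsto_const_nhds.congr' ?_)⟩
  · filter_upwards [hS] with i hi using (ContinuousLinearMap.nonneg_iff_inner.1 hi x).1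
  · filter_upwards [hS] with i hi using (ContinuousLinearMap.nonneg_iff_inner.1 hi x).2.symm

theorem ContinuousLinearMap.opNorm_le_of_tendsto {ι : Type*} {l : Filter ι} [l.NeBot]
    {S : ι → H →L[ℂ] H} {A : H →L[ℂ] H} {C : ℝ} (hS : ∀ᶠ i in l, ‖S i‖ ≤ C)
    (h : ∀ x y, Tendsto (fun i => ⟪x, S i y⟫) l (𝓝 ⟪x, A y⟫)) : ‖A‖ ≤ C := by
  obtain ⟨i, hi⟩ := hS.exists
  refine ContinuousLinearMap.opNorm_le_of_inner ((norm_nonneg _).trans hi) fun x y => ?_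
  refine le_of_tendsto (h x y).norm ?_
  filter_upwards [hS] with i hi using norm_inner_apply_le_of_le hi x y

variable [CompleteSpace H]

/-- A bounded sesquilinear form is given by a bounded operator. -/
theorem exists_operator_of_form (q : H → H → ℂ) (C : ℝ)
    (hadd : ∀ x y z, q x (y + z) = q x y + q x z) (hsmul : ∀ x (c : ℂ) y, q x (c • y) = c * q x y)
    (hadd' : ∀ x y z, q (x + y) z = q x z + q y z)
    (hsmul' : ∀ (c : ℂ) x y, q (c • x) y = starRingEnd ℂ c * q x y)
    (hC : ∀ x y, ‖q x y‖ ≤ C * ‖x‖ * ‖y‖) :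
    ∃ B : H →L[ℂ] H, ∀ x y, ⟪x, B y⟫ = q x y := by
  let f : H →L⋆[ℂ] H →L[ℂ] ℂ := LinearMap.mkContinuous₂
    (LinearMap.mk₂'ₛₗ (starRingEnd ℂ) (RingHom.id ℂ) q hadd' (fun c x y => by simp [hsmul'])
      hadd (fun c x y => by simp [hsmul])) C (fun x y => by simpa using hC x y)
  have hf : ∀ x y, f x y = q x y := fun x y => rfl
  -- `continuousLinearMapOfBilin` represents f with the operator in the first slot; the adjoint
  -- moves it to the second.
  refine ⟨star (InnerProductSpace.continuousLinearMapOfBilin f), fun x y => ?_⟩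
  rw [ContinuousLinearMap.star_eq_adjoint, ContinuousLinearMap.adjoint_inner_right,
    InnerProductSpace.continuousLinearMapOfBilin_apply, hf]

/-- Norm bounded sets of operators are relatively compact for weak convergence. -/
theorem exists_weakLimit {ι : Type*} (u : Ultrafilter ι) (S : ι → H →L[ℂ] H) (C : ℝ)
    (hS : ∀ᶠ i in u, ‖S i‖ ≤ C) :
    ∃ B : H →L[ℂ] H, ∀ x y, Tendsto (fun i => ⟪x, S i y⟫) u (𝓝 ⟪x, B y⟫) := by
  have hlim : ∀ x y : H, ∃ z, Tendsto (fun i => ⟪x, S i y⟫) u (𝓝 z) := by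
    intro x y
    have hK : IsCompact (Metric.closedBall (0 : ℂ) (C * ‖x‖ * ‖y‖)) := isCompact_closedBall _ _
    obtain ⟨z, -, hz⟩ := hK.ultrafilter_le_nhds (u.map fun i => ⟪x, S i y⟫) (by
      rw [le_principal_iff, Ultrafilter.coe_map, mem_map]
      filter_upwards [hS] with i hi
      simpa using norm_inner_apply_le_of_le hi x y)
    exact ⟨z, hz⟩
  choose q hq using hlim
  obtain ⟨B, hB⟩ := exists_operator_of_form q C
    (fun x y z => tendsto_nhds_unique (hq x (y + z))
      (((hq x y).add (hq x z)).congr fun i => by simp))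
    (fun x c y => tendsto_nhds_unique (hq x (c • y))
      (((hq x y).const_mul c).congr fun i => by simp))
    (fun x y z => tendsto_nhds_unique (hq (x + y) z)
      (((hq x z).add (hq y z)).congr fun i => by simp))
    (fun c x y => tendsto_nhds_unique (hq (c • x) y)
      (((hq x y).const_mul _).congr fun i => by simp [mul_comm]))
    (fun x y => le_of_tendsto (hq x y).norm (by
      filter_upwards [hS] with i hi using norm_inner_apply_le_of_le hi x y))
  exact ⟨B, fun x y => by rw [hB]; exact hq x y⟩

end WeakLimits

/-! ### Operators on the tensor product -/

section TensorOperators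

variable {H K : Type*} [NormedAddCommGroup H] [InnerProductSpace ℂ H]
  [NormedAddCommGroup K] [InnerProductSpace ℂ K]

theorem inner_tens (φ φ' : H) (η η' : K) : ⟪tens φ η, tens φ' η'⟫ = ⟪φ, φ'⟫ * ⟪η, η'⟫ := by
  simp [tens]

theorem tens_add_right (φ : H) (η η' : K) : tens φ (η + η') = tens φ η + tens φ η' := by
  simp [tens, TensorProduct.tmul_add, UniformSpace.Completion.coe_add]

theorem tens_smul_right (φ : H) (c : ℂ) (η : K) : tens φ (c • η) = c • tens φ η := by
  simp [tens]

theorem HilbertTensor.induction {p : HilbertTensor H K → Prop} (hc : IsClosed {x | p x})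
    (h0 : p 0) (ht : ∀ φ η, p (tens φ η)) (ha : ∀ x y, p x → p y → p (x + y))
    (x : HilbertTensor H K) : p x := by
  induction x using UniformSpace.Completion.induction_on with
  | hp => exact hc
  | ih a =>
    induction a using TensorProduct.induction_on with
    | zero => exact h0
    | tmul φ η => exact ht φ η
    | add a b h1 h2 => rw [UniformSpace.Completion.coe_add]; exact ha _ _ h1 h2

theorem ext_tens {A B : HilbertTensor H K →L[ℂ] HilbertTensor H K}
    (h : ∀ φ η φ' η', ⟪tens φ η, A (tens φ' η')⟫ = ⟪tens φ η, B (tens φ' η')⟫) : A = B := by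
  refine ContinuousLinearMap.ext_inner_map fun x y => ?_
  induction x using HilbertTensor.induction with
  | hc => exact isClosed_eq (by fun_prop) (by fun_prop)
  | h0 => simp
  | ha x x' h1 h2 => simp [h1, h2]
  | ht φ η =>
    induction y using HilbertTensor.induction with
    | hc => exact isClosed_eq (by fun_prop) (by fun_prop)
    | h0 => simp
    | ha x x' h1 h2 => simp [h1, h2]
    | ht φ' η' => exact h φ η φ' η'

/-- Polarisation in the second factor. -/
theorem ext_tens_diag {A B : HilbertTensor H K →L[ℂ] HilbertTensor H K}
    (h : ∀ φ φ' η, ⟪tens φ η, A (tens φ' η)⟫ = ⟪tens φ η, B (tens φ' η)⟫) : A = B := by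
  refine ext_tens fun φ η φ' η' => ?_
  rw [← sub_eq_zero, ← inner_sub_right, ← sub_apply]
  have h0 : ∀ η, ⟪tens φ η, (A - B) (tens φ' η)⟫ = 0 := fun η => by
    rw [sub_apply, inner_sub_right, h, sub_self]
  have h1 := h0 (η + η')
  have h2 := h0 (η + Complex.I • η')
  simp only [tens_add_right, tens_smul_right, map_add, map_smul, inner_add_left, inner_add_right,
    inner_smul_left, inner_smul_right, h0, Complex.conj_I] at h1 h2
  have h3 := Complex.I_mul_I
  -- With q(η, η') the matrix element, h1 says q(η, η') + q(η', η) = 0 and h2 says i (q(η, η') -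
  -- q(η', η)) = 0.
  linear_combination h1 / 2 - Complex.I / 2 * h2 +
    (⟪tens φ η, (A - B) (tens φ' η')⟫ - ⟪tens φ η', (A - B) (tens φ' η)⟫) / 2 * h3

theorem opTens_add_left (A A' : H →L[ℂ] H) (B : K →L[ℂ] K) :
    opTens (A + A') B = opTens A B + opTens A' B :=
  ext_tens fun _ _ _ _ => by
    simp [opTens_tens, inner_tens, inner_add_right, add_mul]

theorem opTens_add_right (A : H →L[ℂ] H) (B B' : K →L[ℂ] K) :
    opTens A (B + B') = opTens A B + opTens A B' :=
  ext_tens fun _ _ _ _ => by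
    simp [opTens_tens, inner_tens, inner_add_right, mul_add]

theorem opTens_zero_left (B : K →L[ℂ] K) : opTens (0 : H →L[ℂ] H) B = 0 :=
  ext_tens fun _ _ _ _ => by simp [opTens_tens, inner_tens]

theorem opTens_zero_right (A : H →L[ℂ] H) : opTens A (0 : K →L[ℂ] K) = 0 :=
  ext_tens fun _ _ _ _ => by simp [opTens_tens, inner_tens]

theorem opTens_sum_right {ι : Type*} (s : Finset ι) (A : H →L[ℂ] H) (B : ι → K →L[ℂ] K) :
    opTens A (∑ i ∈ s, B i) = ∑ i ∈ s, opTens A (B i) := by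
  classical
  induction s using Finset.induction_on with
  | empty => simp [opTens_zero_right]
  | insert i s hi ih => rw [Finset.sum_insert hi, Finset.sum_insert hi, opTens_add_right, ih]

theorem opTens_mul (A A' : H →L[ℂ] H) (B B' : K →L[ℂ] K) :
    opTens A B * opTens A' B' = opTens (A * A') (B * B') :=
  ext_tens fun _ _ _ _ => by simp [opTens_tens]

theorem opTens_one : opTens (1 : H →L[ℂ] H) (1 : K →L[ℂ] K) = 1 :=
  ext_tens fun _ _ _ _ => by simp [opTens_tens]

theorem norm_opTens_le (A : H →L[ℂ] H) (B : K →L[ℂ] K) : ‖opTens A B‖ ≤ ‖A‖ * ‖B‖ := by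
  refine ContinuousLinearMap.opNorm_le_bound _ (by positivity) fun x => ?_
  induction x using UniformSpace.Completion.induction_on with
  | hp => exact isClosed_le (by fun_prop) (by fun_prop)
  | ih a =>
    rw [opTens, ContinuousLinearMap.completion_apply_coe, UniformSpace.Completion.norm_coe,
      UniformSpace.Completion.norm_coe]
    exact (TensorProduct.mapL A B).le_of_opNorm_le (TensorProduct.norm_mapL_le A B) a

/-- A bounded net of operators on the tensor product converges weakly if it does so between
elementary tensors. -/
theorem tendsto_inner_of_tens {ι : Type*} {l : Filter ι}
    {S : ι → HilbertTensor H K →L[ℂ] HilbertTensor H K} {C : ℝ} (hS : ∀ᶠ i in l, ‖S i‖ ≤ C)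
    {B : HilbertTensor H K →L[ℂ] HilbertTensor H K}
    (h : ∀ φ φ' η, Tendsto (fun i => ⟪tens φ η, S i (tens φ' η)⟫) l
      (𝓝 ⟪tens φ η, B (tens φ' η)⟫)) (x y : HilbertTensor H K) :
    Tendsto (fun i => ⟪x, S i y⟫) l (𝓝 ⟪x, B y⟫) := by
  -- Along every ultrafilter a weak limit exists by compactness, and the elementary tensors identify
  -- it with B. No density estimate is needed.
  rw [tendsto_iff_ultrafilter]
  intro u hu
  obtain ⟨B', hB'⟩ := exists_weakLimit u S C (hu hS)
  have : B' = B := ext_tens_diag fun φ φ' η =>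
    tendsto_nhds_unique (hB' _ _) ((h φ φ' η).mono_left hu)
  exact this ▸ hB' x y

variable [CompleteSpace H] [CompleteSpace K]

theorem star_opTens (A : H →L[ℂ] H) (B : K →L[ℂ] K) :
    star (opTens A B) = opTens (star A) (star B) :=
  ext_tens fun _ _ _ _ => by
    simp [ContinuousLinearMap.star_eq_adjoint, ContinuousLinearMap.adjoint_inner_right,
      opTens_tens, inner_tens]

end TensorOperators

theorem inner_self_eq_ofReal {H : Type*} [NormedAddCommGroup H] [InnerProductSpace ℂ H] (x : H) :
    ⟪x, x⟫ = ((‖x‖ ^ 2 : ℝ) : ℂ) := by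
  rw [inner_self_eq_norm_sq_to_K]; simp

/-! ### Basic properties of positive operator valued measures -/

namespace POM

variable {Ω H : Type*} [MeasurableSpace Ω] [NormedAddCommGroup H] [InnerProductSpace ℂ H]
  (F : POM Ω H)

theorem map_empty : F ∅ = 0 :=
  ContinuousLinearMap.ext_inner_map fun x y => by simp [F.inner_empty]

theorem map_union {X Y : Set Ω} (hX : MeasurableSet X) (hY : MeasurableSet Y) (h : Disjoint X Y) :
    F (X ∪ Y) = F X + F Y := by
  refine ContinuousLinearMap.ext_inner_map fun x y => ?_
  have h1 := F.hasSum' (fun n : ℕ => if n = 0 then X else if n = 1 then Y else ∅)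
    (by intro n; split_ifs <;> simp [hX, hY])
    (by
      intro m n hmn
      split_ifs <;> simp_all [disjoint_comm]) x y
  have h2 : (⋃ n : ℕ, if n = 0 then X else if n = 1 then Y else ∅) = X ∪ Y := by
    ext ω
    simp only [Set.mem_iUnion, Set.mem_union]
    constructor
    · rintro ⟨n, hn⟩
      split_ifs at hn with h0 h1
      · exact Or.inl hn
      · exact Or.inr hn
      · exact hn.elim
    · rintro (hω | hω)
      · exact ⟨0, by simpa using hω⟩
      · exact ⟨1, by simpa using hω⟩
  rw [h2] at h1
  have h3 := hasSum_sum_of_ne_finset_zero (L := .unconditional ℕ) (s := Finset.range 2)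
    (f := fun n : ℕ => ⟪x, F (if n = 0 then X else if n = 1 then Y else ∅) y⟫) (by
      intro n hn
      have : n ≠ 0 ∧ n ≠ 1 := by simp at hn; omega
      simp [this.1, this.2, F.inner_empty])
  have h4 := h1.unique h3
  rw [h4, Finset.sum_range_succ, Finset.sum_range_one, add_apply, inner_add_right]
  simp

theorem map_biUnion {ι : Type*} (t : Finset ι) (X : ι → Set Ω) (hX : ∀ i ∈ t, MeasurableSet (X i))
    (hd : (t : Set ι).PairwiseDisjoint X) : F (⋃ i ∈ t, X i) = ∑ i ∈ t, F (X i) := by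
  classical
  induction t using Finset.induction_on with
  | empty => simp [F.map_empty]
  | insert i t hi ih =>
    rw [Finset.set_biUnion_insert, Finset.sum_insert hi, F.map_union (hX _ (by simp)), ih]
    · exact fun j hj => hX j (by simp [hj])
    · exact hd.subset (by simp)
    · exact Finset.measurableSet_biUnion _ fun j hj => hX j (by simp [hj])
    · rw [Set.disjoint_iUnion₂_right]
      intro j hj
      exact hd (by simp) (by simp [hj]) (by rintro rfl; exact hi hj)

theorem map_le_one {X : Set Ω} (hX : MeasurableSet X) : F X ≤ 1 := by
  have h := F.map_union hX hX.compl disjoint_compl_right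
  rw [Set.union_compl_self, F.univ'] at h
  rw [ContinuousLinearMap.le_def, h, add_sub_cancel_left,
    ← ContinuousLinearMap.nonneg_iff_isPositive]
  exact F.nonneg' _ hX.compl

theorem sum_le_one {ι : Type*} (t : Finset ι) (X : ι → Set Ω) (hX : ∀ i ∈ t, MeasurableSet (X i))
    (hd : (t : Set ι).PairwiseDisjoint X) : ∑ i ∈ t, F (X i) ≤ 1 := by
  rw [← F.map_biUnion t X hX hd]
  exact F.map_le_one (Finset.measurableSet_biUnion _ hX)

theorem measure_apply (η : H) {X : Set Ω} (hX : MeasurableSet X) :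
    F.measure η X = ENNReal.ofReal (⟪η, F X η⟫).re :=
  Measure.ofMeasurable_apply X hX

theorem inner_eq_measure (η : H) {X : Set Ω} (hX : MeasurableSet X) :
    ⟪η, F X η⟫ = ((F.measure η).real X : ℂ) := by
  obtain ⟨h1, h2⟩ := ContinuousLinearMap.nonneg_iff_inner.1 (F.nonneg' X hX) η
  rw [Measure.real, F.measure_apply η hX, ENNReal.toReal_ofReal h1]
  exact Complex.ext rfl h2

instance (η : H) : IsFiniteMeasure (F.measure η) :=
  ⟨by rw [F.measure_apply η MeasurableSet.univ]; exact ENNReal.ofReal_lt_top⟩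

end POM

/-! ### Cauchy–Schwarz estimate for sums of Aᵢ ⊗ Dᵢ -/

section CauchySchwarz

variable {H K : Type*} [NormedAddCommGroup H] [InnerProductSpace ℂ H] [CompleteSpace H]
  [NormedAddCommGroup K] [InnerProductSpace ℂ K] [CompleteSpace K]

/-- D is divided evenly between the two sides, so that Cauchy–Schwarz costs only the norm of A. -/
theorem opTens_eq_sqrt_mul (A : H →L[ℂ] H) {D : K →L[ℂ] K} (hD : 0 ≤ D)
    (x y : HilbertTensor H K) :
    ⟪x, opTens A D y⟫ = ⟪opTens 1 (CFC.sqrt D) x, opTens A 1 (opTens 1 (CFC.sqrt D) y)⟫ := by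
  have hs : ContinuousLinearMap.adjoint (opTens (1 : H →L[ℂ] H) (CFC.sqrt D)) =
      opTens 1 (CFC.sqrt D) := by
    rw [← ContinuousLinearMap.star_eq_adjoint, star_opTens, star_one,
      (CFC.sqrt_nonneg D).isSelfAdjoint.star_eq]
  rw [← ContinuousLinearMap.adjoint_inner_right, hs, ← mul_apply_eq_comp, ← mul_apply_eq_comp,
    opTens_mul, opTens_mul, one_mul, mul_one, mul_one, CFC.sqrt_mul_sqrt_self D hD]

theorem norm_sq_opTens_sqrt {D : K →L[ℂ] K} (hD : 0 ≤ D) (x : HilbertTensor H K) :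
    ‖opTens (1 : H →L[ℂ] H) (CFC.sqrt D) x‖ ^ 2 = (⟪x, opTens (1 : H →L[ℂ] H) D x⟫).re := by
  rw [opTens_eq_sqrt_mul 1 hD, opTens_one, one_apply_eq_self,
    inner_self_eq_ofReal, Complex.ofReal_re]

theorem opTens_one_nonneg {D : K →L[ℂ] K} (hD : 0 ≤ D) : 0 ≤ opTens (1 : H →L[ℂ] H) D := by
  rw [ContinuousLinearMap.nonneg_iff_inner]
  intro x
  rw [opTens_eq_sqrt_mul 1 hD, opTens_one, one_apply_eq_self,
    inner_self_eq_ofReal]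
  exact ⟨sq_nonneg _, rfl⟩

/-- After the splitting by √Dᵢ each term is at most C ‖(1 ⊗ √Dᵢ) x‖ ‖(1 ⊗ √Dᵢ) y‖. The squares of
either factor sum to ⟨z, (1 ⊗ ∑ Dᵢ) z⟩ ≤ ‖z‖², because 1 ⊗ (1 - ∑ Dᵢ) is positive. The bound does
not depend on the number of terms. -/
theorem sum_norm_inner_opTens_le {ι : Type*} (t : Finset ι) {A : ι → H →L[ℂ] H}
    {D : ι → K →L[ℂ] K} {C : ℝ} (hC : 0 ≤ C) (hA : ∀ i ∈ t, ‖A i‖ ≤ C) (hD : ∀ i ∈ t, 0 ≤ D i)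
    (hsum : ∑ i ∈ t, D i ≤ 1) (x y : HilbertTensor H K) :
    ∑ i ∈ t, ‖⟪x, opTens (A i) (D i) y⟫‖ ≤ C * ‖x‖ * ‖y‖ := by
  have hsq : ∀ z : HilbertTensor H K,
      ∑ i ∈ t, ‖opTens (1 : H →L[ℂ] H) (CFC.sqrt (D i)) z‖ ^ 2 ≤ ‖z‖ ^ 2 := by
    intro z
    rw [Finset.sum_congr rfl fun i hi => norm_sq_opTens_sqrt (hD i hi) z, ← Complex.re_sum,
      ← inner_sum, ← sum_apply, ← opTens_sum_right]
    have h1 := opTens_one_nonneg (H := H) (sub_nonneg.2 hsum)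
    have h2 : opTens (1 : H →L[ℂ] H) (∑ i ∈ t, D i) + opTens 1 (1 - ∑ i ∈ t, D i) = 1 := by
      rw [← opTens_add_right, add_sub_cancel, opTens_one]
    have h3 := (ContinuousLinearMap.nonneg_iff_inner.1 h1 z).1
    have h4 : (⟪z, z⟫).re = ‖z‖ ^ 2 := by
      rw [inner_self_eq_ofReal, Complex.ofReal_re]
    have h5 : (⟪z, (opTens (1 : H →L[ℂ] H) (∑ i ∈ t, D i) + opTens 1 (1 - ∑ i ∈ t, D i) :
        HilbertTensor H K →L[ℂ] HilbertTensor H K) z⟫).re = ‖z‖ ^ 2 := by rw [h2, one_apply_eq_self, h4]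
    rw [add_apply, inner_add_right, Complex.add_re] at h5
    linarith
  calc ∑ i ∈ t, ‖⟪x, opTens (A i) (D i) y⟫‖
      ≤ ∑ i ∈ t, C * (‖opTens (1 : H →L[ℂ] H) (CFC.sqrt (D i)) x‖ *
          ‖opTens (1 : H →L[ℂ] H) (CFC.sqrt (D i)) y‖) := by
        refine Finset.sum_le_sum fun i hi => ?_
        rw [opTens_eq_sqrt_mul _ (hD i hi), ← mul_assoc]
        refine norm_inner_apply_le_of_le ((norm_opTens_le _ _).trans ?_) _ _
        have : ‖(1 : K →L[ℂ] K)‖ ≤ 1 := ContinuousLinearMap.norm_id_le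
        calc ‖A i‖ * ‖(1 : K →L[ℂ] K)‖ ≤ C * 1 := by gcongr; exact hA i hi
          _ = C := mul_one C
    _ ≤ C * (‖x‖ * ‖y‖) := by
        rw [← Finset.mul_sum]
        refine mul_le_mul_of_nonneg_left (abs_le_of_sq_le_sq' ?_ (by positivity)).2 hC
        calc _ ≤ _ := Finset.sum_mul_sq_le_sq_mul_sq _ _ _
          _ ≤ ‖x‖ ^ 2 * ‖y‖ ^ 2 := by
            gcongr
            · exact hsq x
            · exact hsq y
          _ = _ := by ring
    _ = C * ‖x‖ * ‖y‖ := by ring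

end CauchySchwarz

/-! ### Tagged finite partitions -/

section Tagged

variable {Ω : Type*} [MeasurableSpace Ω]

/-- Simple functions `s : Ω → Ω` are tagged finite measurable partitions. A property holds
eventually if it holds for all `s` that respect some finite measurable partition. -/
def tagFilter (Ω : Type*) [MeasurableSpace Ω] : Filter (SimpleFunc Ω Ω) :=
  ⨅ t : SimpleFunc Ω ℕ, 𝓟 {s | ∀ ω, t (s ω) = t ω}

theorem eventually_tagFilter (t : SimpleFunc Ω ℕ) : ∀ᶠ s in tagFilter Ω, ∀ ω, t (s ω) = t ω :=
  mem_iInf_of_mem t (mem_principal_self _)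

instance [Nonempty Ω] : (tagFilter Ω).NeBot := by
  have : Nonempty (SimpleFunc Ω Ω) := ⟨SimpleFunc.const Ω (Classical.arbitrary Ω)⟩
  refine iInf_neBot_of_directed ?_ fun t => ?_
  · intro t t'
    refine ⟨(t.pair t').map fun p => Nat.pair p.1 p.2, ?_, ?_⟩ <;>
    · simp only [ge_iff_le, le_principal_iff, mem_principal]
      intro s hs ω
      have := hs ω
      simp only [SimpleFunc.map_apply, SimpleFunc.pair_apply, Nat.pair_eq_pair] at this
      first | exact this.1 | exact this.2
  · rw [principal_neBot_iff]
    -- The map `invFun t ∘ t` sends every point to one chosen representative of its cell, hence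
    -- respects t.
    exact ⟨t.map (Function.invFun t), fun ω => Function.invFun_eq ⟨ω, rfl⟩⟩

/-- The cells are the level sets of ⌊f / ε⌋, which takes finitely many values because f is bounded.
-/
theorem exists_simpleFunc_oscillation_real {f : Ω → ℝ} (hf : Measurable f) {C : ℝ}
    (hC : ∀ ω, |f ω| ≤ C) {ε : ℝ} (hε : 0 < ε) :
    ∃ t : SimpleFunc Ω ℕ, ∀ ω ω', t ω = t ω' → |f ω - f ω'| ≤ ε := by
  let g : SimpleFunc Ω ℤ :=
    { toFun := fun ω => ⌊f ω / ε⌋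
      measurableSet_fiber' := fun n => (hf.div_const ε).floor (measurableSet_singleton n)
      finite_range' := by
        refine (Set.finite_Icc ⌊-C / ε⌋ ⌊C / ε⌋).subset ?_
        rintro _ ⟨ω, rfl⟩
        have := abs_le.1 (hC ω)
        exact ⟨Int.floor_mono (by gcongr; exact this.1), Int.floor_mono (by gcongr; exact this.2)⟩ }
  refine ⟨g.map Encodable.encode, fun ω ω' h => ?_⟩
  have h1 : ⌊f ω / ε⌋ = ⌊f ω' / ε⌋ := Encodable.encode_injective h
  have h2 := Int.abs_sub_lt_one_of_floor_eq_floor h1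
  rw [← sub_div, abs_div, abs_of_pos hε, div_lt_one hε] at h2
  exact h2.le

theorem exists_simpleFunc_oscillation {f : Ω → ℂ} (hf : Measurable f) {C : ℝ}
    (hC : ∀ ω, ‖f ω‖ ≤ C) {ε : ℝ} (hε : 0 < ε) :
    ∃ t : SimpleFunc Ω ℕ, ∀ ω ω', t ω = t ω' → ‖f ω - f ω'‖ ≤ ε := by
  obtain ⟨t, ht⟩ := exists_simpleFunc_oscillation_real (Complex.measurable_re.comp hf)
    (fun ω => (Complex.abs_re_le_norm _).trans (hC ω)) (half_pos hε)
  obtain ⟨t', ht'⟩ := exists_simpleFunc_oscillation_real (Complex.measurable_im.comp hf)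
    (fun ω => (Complex.abs_im_le_norm _).trans (hC ω)) (half_pos hε)
  refine ⟨(t.pair t').map fun p => Nat.pair p.1 p.2, fun ω ω' h => ?_⟩
  simp only [SimpleFunc.map_apply, SimpleFunc.pair_apply, Nat.pair_eq_pair] at h
  refine (Complex.norm_le_abs_re_add_abs_im _).trans ?_
  have h1 := ht _ _ h.1
  have h2 := ht' _ _ h.2
  simp only [Function.comp_apply, ← Complex.sub_re, ← Complex.sub_im] at h1 h2
  linarith

theorem integral_comp_simpleFunc (μ : Measure Ω) [IsFiniteMeasure μ] (f : Ω → ℂ)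
    (s : SimpleFunc Ω Ω) : ∫ ω, f (s ω) ∂μ = ∑ g ∈ s.range, f g * μ.real (s ⁻¹' {g}) := by
  have h : ∀ ω, f (s ω) = ∑ g ∈ s.range, (s ⁻¹' {g}).indicator (fun _ => f g) ω := by
    intro ω
    rw [Finset.sum_eq_single (s ω)]
    · simp
    · intro g _ hg
      exact Set.indicator_of_notMem (fun h => hg h.symm) _
    · simp
  simp_rw [h]
  rw [integral_finsetSum _ fun g _ => (integrable_const _).indicator (s.measurableSet_fiber g)]
  refine Finset.sum_congr rfl fun g _ => ?_
  rw [integral_indicator_const _ (s.measurableSet_fiber g)]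
  simp [mul_comm]

/-- On a partition into cells of oscillation at most δ, replacing ω by its tag s(ω) changes f
uniformly by at most δ, whatever the tags. -/
theorem tendsto_integral_tagFilter (μ : Measure Ω) [IsFiniteMeasure μ] {f : Ω → ℂ}
    (hf : Measurable f) {C : ℝ} (hC : ∀ ω, ‖f ω‖ ≤ C) :
    Tendsto (fun s : SimpleFunc Ω Ω => ∫ ω, f (s ω) ∂μ) (tagFilter Ω) (𝓝 (∫ ω, f ω ∂μ)) := by
  rw [Metric.tendsto_nhds]
  intro ε hε
  -- The summand 1 in the denominator covers the zero measure.
  obtain ⟨δ, hδ, hδε⟩ : ∃ δ > 0, δ * μ.real Set.univ < ε :=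
    ⟨ε / (μ.real Set.univ + 1), by positivity, by
      rw [div_mul_eq_mul_div, div_lt_iff₀ (by positivity)]
      nlinarith [measureReal_nonneg (μ := μ) (s := Set.univ)]⟩
  obtain ⟨t, ht⟩ := exists_simpleFunc_oscillation hf hC hδ
  filter_upwards [eventually_tagFilter t] with s hs
  have hi : Integrable f μ := Integrable.of_bound hf.aestronglyMeasurable C (ae_of_all _ hC)
  have hi' : Integrable (fun ω => f (s ω)) μ :=
    Integrable.of_bound ((s.map f).measurable.aestronglyMeasurable) C (ae_of_all _ fun ω => hC _)
  rw [dist_eq_norm, ← integral_sub hi' hi]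
  refine lt_of_le_of_lt (norm_integral_le_of_norm_le_const (C := δ) (ae_of_all _ fun ω => ?_)) hδε
  exact ht _ _ (hs ω)

end Tagged

theorem nonneg_of_norm_le {Ω E : Type*} [Nonempty Ω] [SeminormedAddGroup E] {a : Ω → E} {C : ℝ}
    (ha : ∀ ω, ‖a ω‖ ≤ C) : 0 ≤ C :=
  (norm_nonneg _).trans (ha (Classical.arbitrary Ω))

/-! ### Bounded weakly measurable operator valued functions -/

/-- `a` is norm bounded and all its matrix elements are measurable. -/
structure BddWeaklyMeasurable {Ω H : Type*} [MeasurableSpace Ω] [NormedAddCommGroup H]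
    [InnerProductSpace ℂ H] (a : Ω → H →L[ℂ] H) : Prop where
  measurable : ∀ x y, Measurable fun ω => ⟪x, a ω y⟫
  bdd : ∃ C, ∀ ω, ‖a ω‖ ≤ C

namespace BddWeaklyMeasurable

variable {Ω H : Type*} [MeasurableSpace Ω] [NormedAddCommGroup H] [InnerProductSpace ℂ H]
  {a b : Ω → H →L[ℂ] H}

theorem const (A : H →L[ℂ] H) : BddWeaklyMeasurable fun _ : Ω => A :=
  ⟨fun _ _ => measurable_const, ‖A‖, fun _ => le_rfl⟩

theorem add (ha : BddWeaklyMeasurable a) (hb : BddWeaklyMeasurable b) :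
    BddWeaklyMeasurable fun ω => a ω + b ω := by
  refine ⟨fun x y => ?_, ?_⟩
  · simp only [add_apply, inner_add_right]
    exact (ha.measurable x y).add (hb.measurable x y)
  · obtain ⟨C, hC⟩ := ha.bdd
    obtain ⟨D, hD⟩ := hb.bdd
    exact ⟨C + D, fun ω => (norm_add_le _ _).trans (add_le_add (hC ω) (hD ω))⟩

theorem sub (ha : BddWeaklyMeasurable a) (hb : BddWeaklyMeasurable b) :
    BddWeaklyMeasurable fun ω => a ω - b ω := by
  refine ⟨fun x y => ?_, ?_⟩
  · simp only [sub_apply, inner_sub_right]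
    exact (ha.measurable x y).sub (hb.measurable x y)
  · obtain ⟨C, hC⟩ := ha.bdd
    obtain ⟨D, hD⟩ := hb.bdd
    exact ⟨C + D, fun ω => (norm_sub_le _ _).trans (add_le_add (hC ω) (hD ω))⟩

theorem const_mul [CompleteSpace H] (ha : BddWeaklyMeasurable a) (A : H →L[ℂ] H) :
    BddWeaklyMeasurable fun ω => A * a ω := by
  refine ⟨fun x y => ?_, ?_⟩
  · have : (fun ω => ⟪x, (A * a ω) y⟫) = fun ω => ⟪ContinuousLinearMap.adjoint A x, a ω y⟫ := by
      ext ω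
      rw [mul_apply_eq_comp, ContinuousLinearMap.adjoint_inner_left]
    rw [this]
    exact ha.measurable _ y
  · obtain ⟨C, hC⟩ := ha.bdd
    exact ⟨‖A‖ * C, fun ω => (norm_mul_le _ _).trans (by gcongr; exact hC ω)⟩

theorem indicator (ha : BddWeaklyMeasurable a) {V : Set Ω} (hV : MeasurableSet V) :
    BddWeaklyMeasurable (V.indicator a) := by
  refine ⟨fun x y => ?_, ?_⟩
  · have : (fun ω => ⟪x, V.indicator a ω y⟫) = V.indicator fun ω => ⟪x, a ω y⟫ := by
      ext ω
      by_cases h : ω ∈ V <;> simp [h]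
    rw [this]
    exact (ha.measurable x y).indicator hV
  · obtain ⟨C, hC⟩ := ha.bdd
    exact ⟨C, fun ω => (norm_indicator_le_norm_self _ _).trans (hC ω)⟩

theorem integrable (ha : BddWeaklyMeasurable a) (μ : Measure Ω) [IsFiniteMeasure μ] (x y : H) :
    Integrable (fun ω => ⟪x, a ω y⟫) μ := by
  obtain ⟨C, hC⟩ := ha.bdd
  exact Integrable.of_bound (ha.measurable x y).aestronglyMeasurable _
    (ae_of_all _ fun ω => norm_inner_apply_le_of_le (hC ω) x y)

/-- A pointwise weak limit of a sequence. -/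
theorem of_tendsto {ι : Type*} {l : Filter ι} [l.NeBot] [l.IsCountablyGenerated]
    {f : ι → Ω → H →L[ℂ] H} (hf : ∀ i, BddWeaklyMeasurable (f i)) {C : ℝ} (hC : ∀ ω, ‖a ω‖ ≤ C)
    (h : ∀ ω x y, Tendsto (fun i => ⟪x, f i ω y⟫) l (𝓝 ⟪x, a ω y⟫)) : BddWeaklyMeasurable a :=
  ⟨fun x y => measurable_of_tendsto_metrizable' l (fun i => (hf i).measurable x y)
    (tendsto_pi_nhds.2 fun ω => h ω x y), C, hC⟩

end BddWeaklyMeasurable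

/-! ### Weak integrals `∫ a(ω) ⊗ F(dω)` -/

section WeakIntegral

variable {Ω : Type*} [MeasurableSpace Ω] {H K : Type*} [NormedAddCommGroup H]
  [InnerProductSpace ℂ H] [NormedAddCommGroup K] [InnerProductSpace ℂ K]
  (F : POM Ω K) {a b : Ω → H →L[ℂ] H}

/-- `B = ∫ a(ω) ⊗ F(dω)` in the weak sense. -/
def IsWeakIntegral (a : Ω → H →L[ℂ] H) (B : HilbertTensor H K →L[ℂ] HilbertTensor H K) : Prop :=
  ∀ (φ φ' : H) (η : K), ⟪tens φ η, B (tens φ' η)⟫ = ∫ ω, ⟪φ, a ω φ'⟫ ∂(F.measure η)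

variable {F} in
theorem IsWeakIntegral.unique {B B' : HilbertTensor H K →L[ℂ] HilbertTensor H K}
    (h : IsWeakIntegral F a B) (h' : IsWeakIntegral F a B') : B = B' :=
  ext_tens_diag fun φ φ' η => (h φ φ' η).trans (h' φ φ' η).symm

/-- The Riemann sum of `a` for a tagged finite partition. -/
noncomputable def riemannSum (a : Ω → H →L[ℂ] H) (s : SimpleFunc Ω Ω) :
    HilbertTensor H K →L[ℂ] HilbertTensor H K :=
  ∑ g ∈ s.range, opTens (a g) (F (s ⁻¹' {g}))

theorem inner_riemannSum (a : Ω → H →L[ℂ] H) (s : SimpleFunc Ω Ω) (x y : HilbertTensor H K) :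
    ⟪x, riemannSum F a s y⟫ = ∑ g ∈ s.range, ⟪x, opTens (a g) (F (s ⁻¹' {g})) y⟫ := by
  rw [riemannSum, sum_apply, inner_sum]

theorem inner_riemannSum_tens (a : Ω → H →L[ℂ] H) (s : SimpleFunc Ω Ω) (φ φ' : H) (η : K) :
    ⟪tens φ η, riemannSum F a s (tens φ' η)⟫ = ∫ ω, ⟪φ, a (s ω) φ'⟫ ∂(F.measure η) := by
  rw [inner_riemannSum, integral_comp_simpleFunc _ fun ω => ⟪φ, a ω φ'⟫]
  refine Finset.sum_congr rfl fun g _ => ?_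
  rw [opTens_tens, inner_tens, F.inner_eq_measure η (s.measurableSet_fiber g)]

theorem tendsto_riemannSum_tens (ha : BddWeaklyMeasurable a) (φ φ' : H) (η : K) :
    Tendsto (fun s => ⟪tens φ η, riemannSum F a s (tens φ' η)⟫) (tagFilter Ω)
      (𝓝 (∫ ω, ⟪φ, a ω φ'⟫ ∂(F.measure η))) := by
  simp only [inner_riemannSum_tens]
  obtain ⟨C, hC⟩ := ha.bdd
  exact tendsto_integral_tagFilter _ (ha.measurable φ φ')
    fun ω => norm_inner_apply_le_of_le (hC ω) φ φ'

theorem pairwiseDisjoint_fibers {α β : Type*} (s : α → β) (t : Set β) :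
    t.PairwiseDisjoint fun g => s ⁻¹' {g} :=
  fun _ _ _ _ h => (Set.disjoint_singleton.2 h).preimage s

open Classical in
/-- The operator `∫ a(ω) ⊗ F(dω)`, with the value `0` if the weak integral does not exist. -/
noncomputable def weakIntegral (a : Ω → H →L[ℂ] H) : HilbertTensor H K →L[ℂ] HilbertTensor H K :=
  if h : ∃ B, IsWeakIntegral F a B then h.choose else 0

variable {F} in
theorem IsWeakIntegral.eq_weakIntegral {B : HilbertTensor H K →L[ℂ] HilbertTensor H K}
    (h : IsWeakIntegral F a B) : weakIntegral F a = B := by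
  have h' : ∃ B, IsWeakIntegral F a B := ⟨B, h⟩
  rw [weakIntegral, dif_pos h']
  exact h'.choose_spec.unique h

theorem weakIntegral_indicator_const (A : H →L[ℂ] H) {V : Set Ω} (hV : MeasurableSet V) :
    weakIntegral F (V.indicator fun _ => A) = opTens A (F V) := by
  refine IsWeakIntegral.eq_weakIntegral fun φ φ' η => ?_
  rw [opTens_tens, inner_tens, F.inner_eq_measure η hV]
  have : (fun ω => ⟪φ, V.indicator (fun _ => A) ω φ'⟫) = V.indicator fun _ => ⟪φ, A φ'⟫ := by
    ext ω
    by_cases h : ω ∈ V <;> simp [h]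
  rw [this, integral_indicator_const _ hV]
  simp [mul_comm]

theorem weakIntegral_const (A : H →L[ℂ] H) : weakIntegral F (fun _ => A) = opTens A 1 := by
  rw [← F.univ', ← weakIntegral_indicator_const F A MeasurableSet.univ, Set.indicator_univ]

variable [CompleteSpace H] [CompleteSpace K]

/-- The effects of the fibres of s sum to at most 1, so the Cauchy–Schwarz estimate bounds all
Riemann sums uniformly in the partition. -/
theorem norm_riemannSum_le {C : ℝ} (hC : 0 ≤ C) (ha : ∀ ω, ‖a ω‖ ≤ C) (s : SimpleFunc Ω Ω) :
    ‖riemannSum F a s‖ ≤ C := by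
  refine ContinuousLinearMap.opNorm_le_of_inner hC fun x y => ?_
  rw [inner_riemannSum]
  refine (norm_sum_le _ _).trans (sum_norm_inner_opTens_le _ hC (fun g _ => ha g)
    (fun g _ => F.nonneg' _ (s.measurableSet_fiber g)) ?_ x y)
  exact F.sum_le_one _ _ (fun g _ => s.measurableSet_fiber g) (pairwiseDisjoint_fibers _ _)

variable [Nonempty Ω]

/-- Some ultrafilter limit of the Riemann sums exists by compactness. Between elementary tensors the
sums converge along the whole filter to the scalar integrals, so this limit has the required matrix
elements. -/
theorem exists_isWeakIntegral (ha : BddWeaklyMeasurable a) : ∃ B, IsWeakIntegral F a B := by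
  obtain ⟨C, hC⟩ := ha.bdd
  obtain ⟨B, hB⟩ := exists_weakLimit (Ultrafilter.of (tagFilter Ω)) (riemannSum F a) C
    (Eventually.of_forall fun s => norm_riemannSum_le F (nonneg_of_norm_le hC) hC s)
  exact ⟨B, fun φ φ' η => tendsto_nhds_unique (hB _ _)
    ((tendsto_riemannSum_tens F ha φ φ' η).mono_left (Ultrafilter.of_le _))⟩

theorem isWeakIntegral_weakIntegral (ha : BddWeaklyMeasurable a) :
    IsWeakIntegral F a (weakIntegral F a) := by
  have h := exists_isWeakIntegral F ha
  rw [weakIntegral, dif_pos h]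
  exact h.choose_spec

/-- The weak integral is the weak limit of its Riemann sums. -/
theorem tendsto_riemannSum (ha : BddWeaklyMeasurable a) (x y : HilbertTensor H K) :
    Tendsto (fun s => ⟪x, riemannSum F a s y⟫) (tagFilter Ω) (𝓝 ⟪x, weakIntegral F a y⟫) := by
  obtain ⟨C, hC⟩ := ha.bdd
  refine tendsto_inner_of_tens
    (Eventually.of_forall fun s => norm_riemannSum_le F (nonneg_of_norm_le hC) hC s)
    (fun φ φ' η => ?_) x y
  rw [isWeakIntegral_weakIntegral F ha]
  exact tendsto_riemannSum_tens F ha φ φ' η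

theorem norm_weakIntegral_le (ha : BddWeaklyMeasurable a) {C : ℝ} (hC : ∀ ω, ‖a ω‖ ≤ C) :
    ‖weakIntegral F a‖ ≤ C :=
  ContinuousLinearMap.opNorm_le_of_tendsto
    (Eventually.of_forall fun s => norm_riemannSum_le F (nonneg_of_norm_le hC) hC s)
    (tendsto_riemannSum F ha)

theorem weakIntegral_add (ha : BddWeaklyMeasurable a) (hb : BddWeaklyMeasurable b) :
    weakIntegral F (fun ω => a ω + b ω) = weakIntegral F a + weakIntegral F b := by
  refine IsWeakIntegral.eq_weakIntegral fun φ φ' η => ?_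
  simp only [add_apply, inner_add_right]
  rw [isWeakIntegral_weakIntegral F ha, isWeakIntegral_weakIntegral F hb,
    integral_add (ha.integrable _ _ _) (hb.integrable _ _ _)]

theorem weakIntegral_sub (ha : BddWeaklyMeasurable a) (hb : BddWeaklyMeasurable b) :
    weakIntegral F (fun ω => a ω - b ω) = weakIntegral F a - weakIntegral F b := by
  refine IsWeakIntegral.eq_weakIntegral fun φ φ' η => ?_
  simp only [sub_apply, inner_sub_right]
  rw [isWeakIntegral_weakIntegral F ha, isWeakIntegral_weakIntegral F hb,
    integral_sub (ha.integrable _ _ _) (hb.integrable _ _ _)]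

theorem weakIntegral_smul (ha : BddWeaklyMeasurable a) (c : ℂ) :
    weakIntegral F (fun ω => c • a ω) = c • weakIntegral F a := by
  refine IsWeakIntegral.eq_weakIntegral fun φ φ' η => ?_
  simp only [smul_apply, inner_smul_right]
  rw [isWeakIntegral_weakIntegral F ha, integral_const_mul]

theorem weakIntegral_star (ha : BddWeaklyMeasurable a) :
    weakIntegral F (fun ω => star (a ω)) = star (weakIntegral F a) := by
  refine IsWeakIntegral.eq_weakIntegral fun φ φ' η => ?_
  simp only [ContinuousLinearMap.star_eq_adjoint, ContinuousLinearMap.adjoint_inner_right]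
  rw [← inner_conj_symm, isWeakIntegral_weakIntegral F ha, ← integral_conj]
  simp only [inner_conj_symm]

/-- Dominated convergence. -/
theorem tendsto_weakIntegral {ι : Type*} {l : Filter ι} [l.NeBot] [l.IsCountablyGenerated]
    {f : ι → Ω → H →L[ℂ] H} (hf : ∀ i, BddWeaklyMeasurable (f i)) {C : ℝ}
    (hC : ∀ i ω, ‖f i ω‖ ≤ C)
    (ha : BddWeaklyMeasurable a)
    (h : ∀ ω x y, Tendsto (fun i => ⟪x, f i ω y⟫) l (𝓝 ⟪x, a ω y⟫)) (x y : HilbertTensor H K) :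
    Tendsto (fun i => ⟪x, weakIntegral F (f i) y⟫) l (𝓝 ⟪x, weakIntegral F a y⟫) := by
  refine tendsto_inner_of_tens
    (Eventually.of_forall fun i => norm_weakIntegral_le F (hf i) (hC i)) (fun φ φ' η => ?_) x y
  simp only [isWeakIntegral_weakIntegral F ha _ _ _, isWeakIntegral_weakIntegral F (hf _) _ _ _]
  exact tendsto_integral_filter_of_dominated_convergence (fun _ => C * ‖φ‖ * ‖φ'‖)
    (Eventually.of_forall fun i => ((hf i).measurable φ φ').aestronglyMeasurable)
    (Eventually.of_forall fun i => ae_of_all _ fun ω => norm_inner_apply_le_of_le (hC i ω) φ φ')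
    (integrable_const _) (ae_of_all _ fun ω => h ω φ φ')

end WeakIntegral

/-! ### Complete positivity -/

section CompletePositivity

variable {Ω : Type*} [MeasurableSpace Ω] [Nonempty Ω] {H K : Type*} [NormedAddCommGroup H]
  [InnerProductSpace ℂ H] [CompleteSpace H] [NormedAddCommGroup K] [InnerProductSpace ℂ K]
  [CompleteSpace K] (F : POM Ω K)

/-- With D = √D √D, the Gram form b* b ⊗ D is again a Gram form, built from b ⊗ √D; hence a sum of
squares. -/
theorem sum_inner_opTens_star_mul {n κ : Type*} [Fintype n] [Fintype κ] (b : κ → n → H →L[ℂ] H)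
    {D : K →L[ℂ] K} (hD : 0 ≤ D) (ξ : n → HilbertTensor H K) :
    ∑ i, ∑ j, ⟪ξ i, opTens (∑ k, star (b k i) * b k j) D (ξ j)⟫ =
      ((∑ k, ‖∑ j, opTens (b k j) (CFC.sqrt D) (ξ j)‖ ^ 2 : ℝ) : ℂ) := by
  have h1 : ∀ i j, opTens (∑ k, star (b k i) * b k j) D =
      ∑ k, star (opTens (b k i) (CFC.sqrt D)) * opTens (b k j) (CFC.sqrt D) := by
    intro i j
    have h2 : ∀ s : Finset κ, opTens (∑ k ∈ s, star (b k i) * b k j) D =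
        ∑ k ∈ s, star (opTens (b k i) (CFC.sqrt D)) * opTens (b k j) (CFC.sqrt D) := by
      classical
      intro s
      induction s using Finset.induction_on with
      | empty => simp [opTens_zero_left]
      | insert k s hk ih =>
        rw [Finset.sum_insert hk, Finset.sum_insert hk, opTens_add_left, ih, star_opTens,
          opTens_mul, (CFC.sqrt_nonneg D).isSelfAdjoint.star_eq, CFC.sqrt_mul_sqrt_self D hD]
    exact h2 _
  simp only [h1, sum_apply, inner_sum, mul_apply_eq_comp]
  simp only [ContinuousLinearMap.star_eq_adjoint, ContinuousLinearMap.adjoint_inner_right]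
  rw [Finset.sum_congr rfl fun i _ => Finset.sum_comm, Finset.sum_comm, Complex.ofReal_sum]
  refine Finset.sum_congr rfl fun k _ => ?_
  rw [← inner_self_eq_ofReal, sum_inner]
  exact Finset.sum_congr rfl fun i _ => (inner_sum _ _ _).symm

/-- The form is a sum of squares for each Riemann sum, and the nonnegative reals are closed in ℂ. No
measurability of b is needed, since only its values at finitely many tags enter. The case of one
index is positivity, the general one complete positivity. -/
theorem weakIntegral_form_nonneg {n κ : Type*} [Fintype n] [Fintype κ]
    {a : n → n → Ω → H →L[ℂ] H} (ha : ∀ i j, BddWeaklyMeasurable (a i j))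
    (b : Ω → κ → n → H →L[ℂ] H) (hab : ∀ ω i j, a i j ω = ∑ k, star (b ω k i) * b ω k j)
    (ξ : n → HilbertTensor H K) :
    0 ≤ (∑ i, ∑ j, ⟪ξ i, weakIntegral F (a i j) (ξ j)⟫).re ∧
      (∑ i, ∑ j, ⟪ξ i, weakIntegral F (a i j) (ξ j)⟫).im = 0 := by
  have hlim : Tendsto (fun s => ∑ i, ∑ j, ⟪ξ i, riemannSum F (a i j) s (ξ j)⟫) (tagFilter Ω)
      (𝓝 (∑ i, ∑ j, ⟪ξ i, weakIntegral F (a i j) (ξ j)⟫)) :=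
    tendsto_finsetSum _ fun i _ => tendsto_finsetSum _ fun j _ => tendsto_riemannSum F (ha i j) _ _
  have hcl : IsClosed {z : ℂ | 0 ≤ z.re ∧ z.im = 0} :=
    (isClosed_le continuous_const Complex.continuous_re).inter
      (isClosed_eq Complex.continuous_im continuous_const)
  refine hcl.mem_of_tendsto hlim (Eventually.of_forall fun s => ?_)
  have h : ∑ i, ∑ j, ⟪ξ i, riemannSum F (a i j) s (ξ j)⟫ =
      ((∑ g ∈ s.range, ∑ k, ‖∑ j, opTens (b g k j) (CFC.sqrt (F (s ⁻¹' {g}))) (ξ j)‖ ^ 2 : ℝ) :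
        ℂ) := by
    simp only [inner_riemannSum, hab]
    rw [Finset.sum_congr rfl fun i _ => Finset.sum_comm, Finset.sum_comm, Complex.ofReal_sum]
    exact Finset.sum_congr rfl fun g _ =>
      sum_inner_opTens_star_mul _ (F.nonneg' _ (s.measurableSet_fiber g)) ξ
  rw [Set.mem_ofPred_eq, h, Complex.ofReal_re]
  exact ⟨by positivity, Complex.ofReal_im _⟩

theorem weakIntegral_nonneg {a : Ω → H →L[ℂ] H} (ha : BddWeaklyMeasurable a) (h : ∀ ω, 0 ≤ a ω) :
    0 ≤ weakIntegral F a := by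
  rw [ContinuousLinearMap.nonneg_iff_inner]
  intro x
  have := weakIntegral_form_nonneg F (n := Unit) (κ := Unit) (a := fun _ _ => a) (fun _ _ => ha)
    (fun ω _ _ => CFC.sqrt (a ω)) (fun ω _ _ => by
      simp [(CFC.sqrt_nonneg (a ω)).isSelfAdjoint.star_eq, CFC.sqrt_mul_sqrt_self _ (h ω)])
    (fun _ => x)
  simpa using this

end CompletePositivity

/-! ### Positivity of operator matrices tested on vectors -/

section MatrixPositivity

open scoped CStarAlgebra

variable {H : Type*} [NormedAddCommGroup H] [InnerProductSpace ℂ H] {k : ℕ}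

theorem CStarMatrix.sum_mul_apply (M N : CStarMatrix (Fin k) (Fin k) (H →L[ℂ] H))
    (ξ : Fin k → H) (i : Fin k) :
    ∑ l, (M * N) i l (ξ l) = ∑ j, M i j (∑ l, N j l (ξ l)) := by
  simp only [CStarMatrix.mul_apply, sum_apply, map_sum, mul_apply_eq_comp]
  exact Finset.sum_comm

theorem CStarMatrix.ext_sum_apply {M N : CStarMatrix (Fin k) (Fin k) (H →L[ℂ] H)}
    (h : ∀ (ξ : Fin k → H) i, ∑ l, M i l (ξ l) = ∑ l, N i l (ξ l)) : M = N := by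
  ext i j x
  have := h (Pi.single j x) i
  rw [Finset.sum_eq_single j, Finset.sum_eq_single j] at this
  · simpa using this
  all_goals simp +contextual

variable [CompleteSpace H]

/-- Here y is the square root of the negative part a⁻, and a a⁻ = -(a⁻)² since a⁺ a⁻ = 0. The
element y serves to build vectors that detect a failure of positivity. -/
theorem IsSelfAdjoint.exists_negPart_sqrt {A : Type*} [NonUnitalCStarAlgebra A] [PartialOrder A]
    [StarOrderedRing A] {a : A} (ha : IsSelfAdjoint a) :
    ∃ y, IsSelfAdjoint y ∧ a * (y * y) = -(y * y * (y * y)) ∧ (y = 0 → 0 ≤ a) := by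
  have h1 := CFC.posPart_sub_negPart a ha
  have h2 := CFC.posPart_mul_negPart a
  have h5 := CFC.sqrt_mul_sqrt_self a⁻ (CFC.negPart_nonneg a)
  refine ⟨CFC.sqrt a⁻, (CFC.sqrt_nonneg a⁻).isSelfAdjoint, ?_, fun h => ?_⟩
  · rw [h5]
    calc a * a⁻ = (a⁺ - a⁻) * a⁻ := by rw [h1]
      _ = -(a⁻ * a⁻) := by rw [sub_mul, h2, zero_sub]
  · rw [h, zero_mul] at h5
    rw [← h1, ← h5, sub_zero]
    exact CFC.posPart_nonneg a

theorem exists_eq_star_mul_self_of_nonneg {A : Type*} [NonUnitalCStarAlgebra A] [PartialOrder A]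
    [StarOrderedRing A] {a : A} (ha : 0 ≤ a) : ∃ b, a = star b * b :=
  CStarAlgebra.nonneg_iff_eq_star_mul_self.1 ha

theorem CStarMatrix.sum_inner_star_mul (M N : CStarMatrix (Fin k) (Fin k) (H →L[ℂ] H))
    (ξ : Fin k → H) :
    ∑ i, ∑ j, ⟪ξ i, (star N * M) i j (ξ j)⟫ = ∑ i, ⟪∑ l, N i l (ξ l), ∑ l, M i l (ξ l)⟫ := by
  simp only [CStarMatrix.mul_apply, CStarMatrix.star_apply, sum_apply, inner_sum, mul_apply_eq_comp]
  simp only [ContinuousLinearMap.star_eq_adjoint, ContinuousLinearMap.adjoint_inner_right,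
    sum_inner]
  rw [Finset.sum_congr rfl fun i _ => Finset.sum_comm, Finset.sum_comm]
  exact Finset.sum_congr rfl fun i _ => Finset.sum_comm

/-- The order on matrices is the algebraic C*-order, so the quadratic form has to be linked to it.
With y² = M⁻, the form at the vector y²ξ equals -‖y³ξ‖². Nonnegativity forces y³ = 0, hence y⁴ = 0,
and the C*-identity, used twice, gives y² = 0 and y = 0. -/
theorem CStarMatrix.nonneg_of_inner {M : CStarMatrix (Fin k) (Fin k) (H →L[ℂ] H)}
    (hM : IsSelfAdjoint M) (h : ∀ ξ : Fin k → H, 0 ≤ (∑ i, ∑ j, ⟪ξ i, M i j (ξ j)⟫).re) :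
    0 ≤ M := by
  obtain ⟨y, hy, h1, h2⟩ := hM.exists_negPart_sqrt
  refine h2 ?_
  have h3 : y * y * y = 0 := by
    refine CStarMatrix.ext_sum_apply fun ξ i => ?_
    have h4 := h fun i => ∑ l, (y * y) i l (ξ l)
    have h5 : ∑ i, ∑ j, ⟪∑ l, (y * y) i l (ξ l), M i j (∑ l, (y * y) j l (ξ l))⟫ =
        -((∑ i, ‖∑ l, (y * y * y) i l (ξ l)‖ ^ 2 : ℝ) : ℂ) := by
      have h6 : star (y * y) * (M * (y * y)) = -(star (y * y * y) * (y * y * y)) := by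
        simp only [star_mul, hy.star_eq, h1, mul_neg, mul_assoc]
      calc _ = ∑ i, ∑ j, ⟪ξ i, (star (y * y) * (M * (y * y))) i j (ξ j)⟫ := by
            rw [CStarMatrix.sum_inner_star_mul]
            refine Finset.sum_congr rfl fun i _ => ?_
            rw [CStarMatrix.sum_mul_apply M, inner_sum]
        _ = -∑ i, ∑ j, ⟪ξ i, (star (y * y * y) * (y * y * y)) i j (ξ j)⟫ := by
            rw [h6]
            simp [Finset.sum_neg_distrib]
        _ = _ := by
            rw [CStarMatrix.sum_inner_star_mul, Complex.ofReal_sum]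
            simp only [inner_self_eq_ofReal]
    rw [h5, Complex.neg_re, Complex.ofReal_re, Left.nonneg_neg_iff] at h4
    have h7 := (Finset.sum_eq_zero_iff_of_nonneg fun i _ => by positivity).1
      (le_antisymm h4 (by positivity)) i (Finset.mem_univ i)
    simpa using h7
  have h8 : y * y = 0 := by
    have : star (y * y) * (y * y) = 0 := by
      rw [star_mul, hy.star_eq, ← mul_assoc, h3, zero_mul]
    exact (CStarRing.star_mul_self_eq_zero_iff _).1 this
  rw [← CStarRing.star_mul_self_eq_zero_iff, hy.star_eq, h8]

end MatrixPositivity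

/-! ### The relativisation map -/

section ConjAct

variable {G : Type*} [Group G] {H : Type*} [NormedAddCommGroup H] [InnerProductSpace ℂ H]
  [CompleteSpace H] (U : G →* unitary (H →L[ℂ] H))

theorem star_coe_unitary (g : G) :
    star (U g : H →L[ℂ] H) = (U g⁻¹ : H →L[ℂ] H) := by
  rw [map_inv, ← Unitary.star_eq_inv, Unitary.coe_star]

theorem inner_conjAct (g : G) (A : H →L[ℂ] H) (x y : H) :
    ⟪x, conjAct U g A y⟫ = ⟪(U g⁻¹ : H →L[ℂ] H) x, A ((U g⁻¹ : H →L[ℂ] H) y)⟫ := by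
  rw [conjAct, mul_apply_eq_comp, mul_apply_eq_comp, ← ContinuousLinearMap.adjoint_inner_left,
    ← ContinuousLinearMap.star_eq_adjoint, star_coe_unitary]

theorem norm_coe_unitary_le (u : unitary (H →L[ℂ] H)) : ‖(u : H →L[ℂ] H)‖ ≤ 1 := by
  simpa using (CStarRing.norm_coe_unitary_mul u 1).le.trans ContinuousLinearMap.norm_id_le

theorem norm_conjAct_le (g : G) (A : H →L[ℂ] H) : ‖conjAct U g A‖ ≤ ‖A‖ := by
  have h := norm_coe_unitary_le (U g)
  calc ‖conjAct U g A‖ ≤ ‖(U g : H →L[ℂ] H)‖ * ‖A‖ * ‖star (U g : H →L[ℂ] H)‖ :=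
        (norm_mul_le _ _).trans (by gcongr; exact norm_mul_le _ _)
    _ ≤ 1 * ‖A‖ * 1 := by
        rw [norm_star]
        gcongr
    _ = ‖A‖ := by ring

theorem conjAct_one (g : G) : conjAct U g 1 = 1 := by
  rw [conjAct, mul_one]; exact Unitary.mul_star_self_of_mem (U g).2

theorem conjAct_add (g : G) (A B : H →L[ℂ] H) :
    conjAct U g (A + B) = conjAct U g A + conjAct U g B := by
  simp [conjAct, mul_add, add_mul]

theorem conjAct_smul (g : G) (c : ℂ) (A : H →L[ℂ] H) :
    conjAct U g (c • A) = c • conjAct U g A := by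
  simp [conjAct]

theorem conjAct_star (g : G) (A : H →L[ℂ] H) : conjAct U g (star A) = star (conjAct U g A) := by
  simp [conjAct, mul_assoc]

theorem conjAct_mul (g : G) (A B : H →L[ℂ] H) :
    conjAct U g (A * B) = conjAct U g A * conjAct U g B := by
  have h : star (U g : H →L[ℂ] H) * (U g : H →L[ℂ] H) = 1 := Unitary.star_mul_self_of_mem (U g).2
  calc conjAct U g (A * B) = U g * A * 1 * B * star (U g : H →L[ℂ] H) := by
        rw [conjAct, mul_one]; simp only [mul_assoc]
    _ = _ := by rw [← h]; simp only [conjAct, mul_assoc]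

theorem conjAct_mul_left (g h : G) (A : H →L[ℂ] H) :
    conjAct U (g * h) A = conjAct U g (conjAct U h A) := by
  simp [conjAct, mul_assoc]

theorem conjAct_rankOne (g : G) (x y : H) :
    conjAct U g (InnerProductSpace.rankOne ℂ x y) =
      InnerProductSpace.rankOne ℂ ((U g : H →L[ℂ] H) x) ((U g : H →L[ℂ] H) y) := by
  ext z
  simp [conjAct, ContinuousLinearMap.star_eq_adjoint, ContinuousLinearMap.adjoint_inner_right]

theorem conjAct_nonneg (g : G) {A : H →L[ℂ] H} (hA : 0 ≤ A) : 0 ≤ conjAct U g A := by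
  rw [ContinuousLinearMap.nonneg_iff_inner] at hA ⊢
  intro x
  rw [inner_conjAct]
  exact hA _

variable [TopologicalSpace G] [IsTopologicalGroup G]

theorem continuous_inner_conjAct (hU : ∀ x : H, Continuous fun g => (U g : H →L[ℂ] H) x)
    (A : H →L[ℂ] H) (x y : H) : Continuous fun g => ⟪x, conjAct U g A y⟫ := by
  simp only [inner_conjAct]
  exact ((hU x).comp continuous_inv).inner (A.continuous.comp ((hU y).comp continuous_inv))

variable [MeasurableSpace G] [BorelSpace G]

theorem bddWeaklyMeasurable_conjAct (hU : ∀ x : H, Continuous fun g => (U g : H →L[ℂ] H) x)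
    (A : H →L[ℂ] H) : BddWeaklyMeasurable fun g => conjAct U g A :=
  ⟨fun x y => (continuous_inner_conjAct U hU A x y).measurable, ‖A‖, fun g => norm_conjAct_le U g A⟩

end ConjAct

section Relativise

variable {G : Type*} [Group G] [MeasurableSpace G]
  {HS : Type*} [NormedAddCommGroup HS] [InnerProductSpace ℂ HS] [CompleteSpace HS]
  {HR : Type*} [NormedAddCommGroup HR] [InnerProductSpace ℂ HR]

/-- `IsRelativisation` unfolds to `IsWeakIntegral` for the orbit g ↦ α_g(A), and both definitions
make the same choice, so all facts about weak integrals transfer. -/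
theorem relativise_eq_weakIntegral (US : G →* unitary (HS →L[ℂ] HS)) (F : POM G HR)
    (A : HS →L[ℂ] HS) : relativise US F A = weakIntegral F fun g => conjAct US g A :=
  rfl

theorem relativise_of_invariant (US : G →* unitary (HS →L[ℂ] HS)) (F : POM G HR)
    {A : HS →L[ℂ] HS} (hA : ∀ g, conjAct US g A = A) :
    relativise US F A = opTens A 1 := by
  simp only [relativise_eq_weakIntegral, hA, weakIntegral_const]

theorem relativise_one (US : G →* unitary (HS →L[ℂ] HS)) (F : POM G HR) : relativise US F 1 = 1 := by
  rw [relativise_of_invariant US F (conjAct_one US), opTens_one]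

variable [TopologicalSpace G] [IsTopologicalGroup G] [BorelSpace G] [CompleteSpace HR]
  {US : G →* unitary (HS →L[ℂ] HS)} (hUS : ∀ x : HS, Continuous fun g => (US g : HS →L[ℂ] HS) x)
  (F : POM G HR)

include hUS

theorem isRelativisation_relativise (A : HS →L[ℂ] HS) :
    IsRelativisation US F A (relativise US F A) :=
  isWeakIntegral_weakIntegral F (bddWeaklyMeasurable_conjAct US hUS A)

theorem relativise_add (A B : HS →L[ℂ] HS) :
    relativise US F (A + B) = relativise US F A + relativise US F B := by
  simp only [relativise_eq_weakIntegral, conjAct_add]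
  exact weakIntegral_add F (bddWeaklyMeasurable_conjAct US hUS A)
    (bddWeaklyMeasurable_conjAct US hUS B)

theorem relativise_smul (c : ℂ) (A : HS →L[ℂ] HS) :
    relativise US F (c • A) = c • relativise US F A := by
  simp only [relativise_eq_weakIntegral, conjAct_smul]
  exact weakIntegral_smul F (bddWeaklyMeasurable_conjAct US hUS A) c

theorem relativise_star (A : HS →L[ℂ] HS) :
    relativise US F (star A) = star (relativise US F A) := by
  simp only [relativise_eq_weakIntegral, conjAct_star]
  exact weakIntegral_star F (bddWeaklyMeasurable_conjAct US hUS A)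

theorem relativise_nonneg {A : HS →L[ℂ] HS} (hA : 0 ≤ A) : 0 ≤ relativise US F A :=
  weakIntegral_nonneg F (bddWeaklyMeasurable_conjAct US hUS A) fun g => conjAct_nonneg US g hA

theorem norm_relativise_le (A : HS →L[ℂ] HS) : ‖relativise US F A‖ ≤ ‖A‖ :=
  norm_weakIntegral_le F (bddWeaklyMeasurable_conjAct US hUS A) fun g => norm_conjAct_le US g A

/-- Matrix elements of α_g(aᵢ) are matrix elements of aᵢ at vectors moved by U(g⁻¹), so weak
convergence holds at every g with the same norm bound, and dominated convergence applies. -/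
theorem tendsto_relativise {ι : Type*} {l : Filter ι} [l.NeBot] [l.IsCountablyGenerated]
    {a : ι → HS →L[ℂ] HS} {A : HS →L[ℂ] HS} {C : ℝ} (hC : ∀ i, ‖a i‖ ≤ C)
    (h : ∀ x y, Tendsto (fun i => ⟪x, a i y⟫) l (𝓝 ⟪x, A y⟫)) (Φ Ψ : HilbertTensor HS HR) :
    Tendsto (fun i => ⟪Φ, relativise US F (a i) Ψ⟫) l (𝓝 ⟪Φ, relativise US F A Ψ⟫) := by
  simp only [relativise_eq_weakIntegral]
  refine tendsto_weakIntegral F (fun i => bddWeaklyMeasurable_conjAct US hUS (a i))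
    (fun i g => (norm_conjAct_le US g (a i)).trans (hC i)) (bddWeaklyMeasurable_conjAct US hUS A)
    (fun g x y => ?_) Φ Ψ
  simp only [inner_conjAct]
  exact h _ _

/-- Relativisation as a linear map. -/
noncomputable def relativiseLinear : (HS →L[ℂ] HS) →ₗ[ℂ]
    (HilbertTensor HS HR →L[ℂ] HilbertTensor HS HR) where
  toFun := relativise US F
  map_add' := relativise_add hUS F
  map_smul' := relativise_smul hUS F

theorem relativiseLinear_apply (A : HS →L[ℂ] HS) : relativiseLinear hUS F A = relativise US F A :=
  rfl

theorem relativise_sub (A B : HS →L[ℂ] HS) :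
    relativise US F (A - B) = relativise US F A - relativise US F B :=
  map_sub (relativiseLinear hUS F) A B

theorem relativise_mono {A B : HS →L[ℂ] HS} (h : A ≤ B) :
    relativise US F A ≤ relativise US F B := by
  rw [← sub_nonneg, ← relativise_sub hUS]
  exact relativise_nonneg hUS F (sub_nonneg.2 h)

open scoped CStarAlgebra in
theorem exists_completelyPositiveMap_relativise :
    ∃ Λ : (HS →L[ℂ] HS) →CP (HilbertTensor HS HR →L[ℂ] HilbertTensor HS HR),
      ∀ A, Λ A = relativise US F A := by
  refine ⟨{ relativiseLinear hUS F with map_cstarMatrix_nonneg' := fun k M hM => ?_ },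
    fun A => rfl⟩
  refine CStarMatrix.nonneg_of_inner ?_ fun ξ => ?_
  · have hsa : IsSelfAdjoint M := by
      obtain ⟨N, rfl⟩ := exists_eq_star_mul_self_of_nonneg hM
      exact IsSelfAdjoint.star_mul_self N
    ext1 i j
    have h := congrArg (fun N => N i j) hsa.star_eq
    simp only [CStarMatrix.star_apply] at h
    rw [CStarMatrix.star_apply, CStarMatrix.map_apply, CStarMatrix.map_apply]
    change star (relativise US F (M j i)) = relativise US F (M i j)
    rw [← relativise_star hUS, h]
  · obtain ⟨N, rfl⟩ := exists_eq_star_mul_self_of_nonneg hM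
    -- Since α_g is a *-homomorphism, the entries of N* N go to ∑ₖ α_g(Nₖᵢ)* α_g(Nₖⱼ), the Gram
    -- shape required.
    refine (weakIntegral_form_nonneg F (a := fun i j g => conjAct US g ((star N * N) i j))
      (fun i j => bddWeaklyMeasurable_conjAct US hUS _) (fun g k j => conjAct US g (N k j))
      (fun g i j => ?_) ξ).1
    have hsum : ∀ (s : Finset (Fin k)) (f : Fin k → HS →L[ℂ] HS),
        conjAct US g (∑ i ∈ s, f i) = ∑ i ∈ s, conjAct US g (f i) := fun s f => by
      simp [conjAct, Finset.mul_sum, Finset.sum_mul]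
    rw [CStarMatrix.mul_apply, hsum]
    exact Finset.sum_congr rfl fun l _ => by rw [conjAct_mul, CStarMatrix.star_apply, conjAct_star]

theorem exists_pom_relativise {Ω : Type*} [MeasurableSpace Ω] (E : POM Ω HS) :
    ∃ E' : POM Ω (HilbertTensor HS HR), ∀ X, E' X = relativise US F (E X) := by
  refine ⟨⟨fun X => relativise US F (E X), by rw [E.univ', relativise_one],
    fun X hX => relativise_nonneg hUS F (E.nonneg' X hX), fun X hX hd Φ Ψ => ?_⟩, fun X => rfl⟩
  have hsum : ∀ s : Finset ℕ, ∑ i ∈ s, E (X i) = E (⋃ i ∈ s, X i) := fun s =>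
    (E.map_biUnion s X (fun i _ => hX i) (hd.set_pairwise _)).symm
  -- The finite partial sums are values of E, hence of norm at most 1, and converge weakly. Weak
  -- continuity along finite subsets of ℕ is then the σ-additivity.
  have h := tendsto_relativise (US := US) hUS F (l := atTop)
    (a := fun s : Finset ℕ => ∑ i ∈ s, E (X i)) (A := E (⋃ i, X i)) (C := 1) (fun s => ?_)
    (fun x y => ?_) Φ Ψ
  · refine Tendsto.congr (fun s => ?_) h
    rw [← inner_sum, ← sum_apply]
    exact congrArg (fun B => ⟪Φ, B Ψ⟫) (map_sum (relativiseLinear hUS F) _ _)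
  · have hm : MeasurableSet (⋃ i ∈ s, X i) := Finset.measurableSet_biUnion _ fun i _ => hX i
    rw [hsum]
    exact (CStarAlgebra.norm_le_norm_of_nonneg_of_le (E.nonneg' _ hm) (E.map_le_one hm)).trans
      ContinuousLinearMap.norm_id_le
  · simp only [sum_apply, inner_sum]
    exact E.hasSum' X hX hd x y

theorem isCovariant_relativise {UR : G →* unitary (HR →L[ℂ] HR)} (hF : IsCovariant UR F) (g : G)
    (A : HS →L[ℂ] HS) :
    opTens (US g : HS →L[ℂ] HS) (UR g : HR →L[ℂ] HR) * relativise US F A *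
      star (opTens (US g : HS →L[ℂ] HS) (UR g : HR →L[ℂ] HR)) = relativise US F A := by
  -- Covariance in terms of measures: left translation by g carries the measure of U(g⁻¹)η to that
  -- of η. The rest is a change of variables.
  have hmeas : ∀ η : HR, (F.measure ((UR g⁻¹ : HR →L[ℂ] HR) η)).map (g * ·) = F.measure η := by
    intro η
    ext X hX
    rw [Measure.map_apply (measurable_const_mul g) hX, F.measure_apply _ hX,
      F.measure_apply _ (measurable_const_mul g hX), ← inner_conjAct, ← hF _ _
      (measurable_const_mul g hX), Set.image_preimage_eq _ fun x => ⟨g⁻¹ * x, mul_inv_cancel_left g x⟩]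
  refine (isRelativisation_relativise hUS F A |> IsWeakIntegral.unique <| fun φ φ' η => ?_).symm
  rw [mul_apply_eq_comp, mul_apply_eq_comp, ← ContinuousLinearMap.adjoint_inner_left,
    ← ContinuousLinearMap.star_eq_adjoint, star_opTens, opTens_tens, opTens_tens,
    star_coe_unitary, star_coe_unitary, isRelativisation_relativise hUS F A, ← hmeas η,
    integral_map (measurable_const_mul g).aemeasurable
      (continuous_inner_conjAct US hUS A φ φ').measurable.aestronglyMeasurable]
  refine integral_congr_ae (ae_of_all _ fun h => ?_)
  simp only [conjAct_mul_left US g h]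
  rw [inner_conjAct US g]

end Relativise

/-! ### Riemann sums -/

section RiemannSums

variable {Ω : Type*} [MeasurableSpace Ω] {H K : Type*} [NormedAddCommGroup H]
  [InnerProductSpace ℂ H] [NormedAddCommGroup K] [InnerProductSpace ℂ K]

theorem BddWeaklyMeasurable.sum {ι : Type*} (t : Finset ι) {f : ι → Ω → H →L[ℂ] H}
    (hf : ∀ i ∈ t, BddWeaklyMeasurable (f i)) : BddWeaklyMeasurable fun ω => ∑ i ∈ t, f i ω := by
  classical
  induction t using Finset.induction_on with
  | empty => simpa using BddWeaklyMeasurable.const (0 : H →L[ℂ] H)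
  | insert i t hi ih =>
    simp only [Finset.sum_insert hi]
    exact (hf i (by simp)).add (ih fun j hj => hf j (by simp [hj]))

variable [Nonempty Ω] [CompleteSpace H] [CompleteSpace K] (F : POM Ω K)

theorem weakIntegral_sum {ι : Type*} (t : Finset ι) {f : ι → Ω → H →L[ℂ] H}
    (hf : ∀ i ∈ t, BddWeaklyMeasurable (f i)) :
    weakIntegral F (fun ω => ∑ i ∈ t, f i ω) = ∑ i ∈ t, weakIntegral F (f i) := by
  classical
  induction t using Finset.induction_on with
  | empty => simpa [opTens_zero_left] using weakIntegral_const F (0 : H →L[ℂ] H)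
  | insert i t hi ih =>
    have hf' : ∀ j ∈ t, BddWeaklyMeasurable (f j) := fun j hj => hf j (by simp [hj])
    simp only [Finset.sum_insert hi]
    rw [weakIntegral_add F (hf i (by simp)) (BddWeaklyMeasurable.sum t hf'), ih hf']

/-- The weak integral of a function that is constant on the cells of a countable partition. -/
theorem hasSum_weakIntegral {V : ℕ → Set Ω} (hV : ∀ n, MeasurableSet (V n))
    (hd : Pairwise fun m n => Disjoint (V m) (V n)) (hc : ⋃ n, V n = Set.univ)
    {B : ℕ → H →L[ℂ] H} {b : Ω → H →L[ℂ] H} {C : ℝ} (hB : ∀ n, ‖B n‖ ≤ C)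
    (hb : ∀ n, ∀ ω ∈ V n, b ω = B n) :
    BddWeaklyMeasurable b ∧ ∀ Φ Ψ : HilbertTensor H K,
      HasSum (fun n => ⟪Φ, opTens (B n) (F (V n)) Ψ⟫) ⟪Φ, weakIntegral F b Ψ⟫ := by
  have hcell : ∀ ω, ∃ n, ω ∈ V n := fun ω => Set.mem_iUnion.1 (hc ▸ Set.mem_univ ω)
  have hterm : ∀ n, BddWeaklyMeasurable ((V n).indicator fun _ => B n) := fun n =>
    (BddWeaklyMeasurable.const (B n)).indicator (hV n)
  have hval : ∀ (s : Finset ℕ) (n) (ω), ω ∈ V n →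
      ∑ i ∈ s, (V i).indicator (fun _ => B i) ω = if n ∈ s then B n else 0 := by
    intro s n ω hω
    have : ∀ i, (V i).indicator (fun _ => B i) ω = if i = n then B n else 0 := by
      intro i
      split_ifs with h
      · subst h; simp [hω]
      · exact Set.indicator_of_notMem (fun hi => Set.disjoint_left.1 (hd h) hi hω) _
    simp [this]
  -- At a given ω the partial sums are constant once the index of its cell is included.
  have hlim : ∀ ω x y, Tendsto
      (fun s : Finset ℕ => ⟪x, (∑ i ∈ s, (V i).indicator (fun _ => B i) ω) y⟫) atTop
      (𝓝 ⟪x, b ω y⟫) := by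
    intro ω x y
    obtain ⟨n, hn⟩ := hcell ω
    refine tendsto_const_nhds.congr' ?_
    filter_upwards [eventually_ge_atTop {n}] with s hs
    rw [hval s n ω hn, if_pos (by simpa using hs), hb n ω hn]
  have hbd : BddWeaklyMeasurable b :=
    BddWeaklyMeasurable.of_tendsto (C := C) (fun s => BddWeaklyMeasurable.sum s fun i _ => hterm i)
      (fun ω => by
        obtain ⟨n, hn⟩ := hcell ω
        rw [hb n ω hn]; exact hB n) hlim
  refine ⟨hbd, fun Φ Ψ => ?_⟩
  refine (tendsto_weakIntegral F (fun s => BddWeaklyMeasurable.sum s fun i _ => hterm i)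
    (C := C) (fun s ω => ?_) hbd hlim Φ Ψ).congr fun s => ?_
  · obtain ⟨n, hn⟩ := hcell ω
    rw [hval s n ω hn]
    split_ifs
    · exact hB n
    · simpa using (norm_nonneg _).trans (hB n)
  · rw [weakIntegral_sum F s fun i _ => hterm i, sum_apply, inner_sum]
    simp only [weakIntegral_indicator_const F _ (hV _)]

end RiemannSums

/-! ### Existence of meshes and norm convergence of Riemann sums -/

section Mesh

variable {G : Type*} [Group G] [TopologicalSpace G] [MeasurableSpace G] [BorelSpace G]
  {HS : Type*} [NormedAddCommGroup HS] [InnerProductSpace ℂ HS] [CompleteSpace HS]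
  {HR : Type*} [NormedAddCommGroup HR] [InnerProductSpace ℂ HR]
  {US : G →* unitary (HS →L[ℂ] HS)}

/-- The cells are the sets where the orbit is within ε‖A‖/2 of its value at a point of a dense
sequence, made disjoint; two such distances add up to ε‖A‖. -/
theorem exists_isMesh [SecondCountableTopology G] {A : HS →L[ℂ] HS}
    (hA : Continuous fun g => conjAct US g A) {ε : ℝ} (hε : 0 < ε) : ∃ V, IsMesh US A ε V := by
  let d := TopologicalSpace.denseSeq G
  let W : ℕ → Set G := fun n => {g | ‖conjAct US g A - conjAct US (d n) A‖ ≤ ε * ‖A‖ / 2}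
  have hW : ∀ n, IsClosed (W n) := fun n =>
    isClosed_le (hA.sub continuous_const).norm continuous_const
  have hcover : ⋃ n, W n = Set.univ := by
    rw [Set.iUnion_eq_univ_iff]
    intro g
    -- For A = 0 the radius vanishes and the open set used below would be empty.
    rcases eq_or_ne A 0 with rfl | hA0
    · exact ⟨0, by simp [W, conjAct]⟩
    · have ho : IsOpen {h | ‖conjAct US g A - conjAct US h A‖ < ε * ‖A‖ / 2} :=
        isOpen_lt (continuous_const.sub hA).norm continuous_const
      obtain ⟨n, hn⟩ := (TopologicalSpace.denseRange_denseSeq G).exists_mem_open ho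
        ⟨g, by simpa using by positivity⟩
      exact ⟨n, le_of_lt (show ‖conjAct US g A - conjAct US (d n) A‖ < _ from hn)⟩
  refine ⟨disjointed W, fun n => .disjointed (fun n => (hW n).measurableSet) n,
    disjoint_disjointed W, by rw [iUnion_disjointed, hcover], fun n g hg g' hg' => ?_⟩
  have h1 : ‖conjAct US g A - conjAct US (d n) A‖ ≤ ε * ‖A‖ / 2 := disjointed_subset W n hg
  have h2 : ‖conjAct US g' A - conjAct US (d n) A‖ ≤ ε * ‖A‖ / 2 := disjointed_subset W n hg'
  calc ‖conjAct US g A - conjAct US g' A‖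
      = ‖(conjAct US g A - conjAct US (d n) A) - (conjAct US g' A - conjAct US (d n) A)‖ := by
        rw [sub_sub_sub_cancel_right]
    _ ≤ _ := norm_sub_le _ _
    _ ≤ ε * ‖A‖ := by linarith

variable [IsTopologicalGroup G] [CompleteSpace HR]

/-- The Riemann sum is the weak integral of the step function with value α_{pₙ}(A) on Vₙ. That
function is uniformly within ε‖A‖ of the orbit, so the norm bound for weak integrals gives the
estimate. Points attached to empty cells do not matter, as F(∅) = 0. -/
theorem IsMesh.exists_isRiemannSum (hUS : ∀ x : HS, Continuous fun g => (US g : HS →L[ℂ] HS) x)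
    (F : POM G HR) {A : HS →L[ℂ] HS} {ε : ℝ} {V : ℕ → Set G} (hV : IsMesh US A ε V) {p : ℕ → G}
    (hp : ∀ n, (V n).Nonempty → p n ∈ V n) :
    ∃ S, IsRiemannSum US F A V p S ∧ ‖S - relativise US F A‖ ≤ ε * ‖A‖ := by
  have hcell : ∀ g, ∃ n, g ∈ V n := fun g => Set.mem_iUnion.1 (hV.cover ▸ Set.mem_univ g)
  choose N hN using hcell
  have hb : ∀ n, ∀ g ∈ V n, conjAct US (p (N g)) A = conjAct US (p n) A := by
    intro n g hg
    have : N g = n := by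
      by_contra h
      exact Set.disjoint_left.1 (hV.disjoint h) (hN g) hg
    rw [this]
  obtain ⟨h1, h2⟩ := hasSum_weakIntegral F hV.measurable hV.disjoint hV.cover
    (fun n => norm_conjAct_le US (p n) A) hb
  have h3 := bddWeaklyMeasurable_conjAct US hUS A
  refine ⟨_, h2, ?_⟩
  rw [relativise_eq_weakIntegral, ← weakIntegral_sub F h1 h3]
  exact norm_weakIntegral_le F (h1.sub h3) fun g =>
    hV.width (N g) _ (hp _ ⟨g, hN g⟩) _ (hN g)

theorem ContinuousLinearMap.tendsto_of_norm_sub_le {H : Type*} [NormedAddCommGroup H]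
    [NormedSpace ℂ H] {S : ℕ → H →L[ℂ] H} {A : H →L[ℂ] H} {ε : ℕ → ℝ} {c : ℝ}
    (hε : Tendsto ε atTop (𝓝 0)) (h : ∀ N, ‖S N - A‖ ≤ ε N * c) : Tendsto S atTop (𝓝 A) :=
  tendsto_iff_norm_sub_tendsto_zero.2 <|
    squeeze_zero (fun _ => norm_nonneg _) h (by simpa using hε.mul_const c)

theorem exists_tendsto_riemannSums (hUS : ∀ x : HS, Continuous fun g => (US g : HS →L[ℂ] HS) x)
    (F : POM G HR) {A : HS →L[ℂ] HS} {ε : ℕ → ℝ} {V : ℕ → ℕ → Set G} {p : ℕ → ℕ → G}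
    (hε : Tendsto ε atTop (𝓝 0)) (hV : ∀ N, IsMesh US A (ε N) (V N))
    (hp : ∀ N n, (V N n).Nonempty → p N n ∈ V N n) :
    ∃ S : ℕ → HilbertTensor HS HR →L[ℂ] HilbertTensor HS HR,
      (∀ N, IsRiemannSum US F A (V N) (p N) (S N)) ∧
        Tendsto S atTop (𝓝 (relativise US F A)) := by
  choose S hS using fun N => (hV N).exists_isRiemannSum hUS F (hp N)
  exact ⟨S, fun N => (hS N).1, ContinuousLinearMap.tendsto_of_norm_sub_le hε fun N => (hS N).2⟩

end Mesh

/-! ### Approximation by operators of finite rank -/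

section FiniteRank

variable {H : Type*} [NormedAddCommGroup H] [InnerProductSpace ℂ H]

variable (H) in
/-- The operators of finite rank, as the span of the operators of rank one. -/
def finiteRankOperators : Submodule ℂ (H →L[ℂ] H) :=
  Submodule.span ℂ (Set.range fun p : H × H => InnerProductSpace.rankOne ℂ p.1 p.2)

theorem continuous_rankOne :
    Continuous fun p : H × H => InnerProductSpace.rankOne ℂ p.1 p.2 :=
  ((ContinuousLinearMap.smulRightL ℂ H H).continuous.comp
    ((innerSL ℂ).continuous.comp continuous_snd)).clm_apply continuous_fst

theorem starProjection_mul_mem_finiteRankOperators (U : Submodule ℂ H) [FiniteDimensional ℂ U]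
    (A : H →L[ℂ] H) : A * U.starProjection ∈ finiteRankOperators H := by
  rw [(stdOrthonormalBasis ℂ U).starProjection_eq_sum_rankOne, Finset.mul_sum]
  refine Submodule.sum_mem _ fun i _ => ?_
  rw [ContinuousLinearMap.mul_def, InnerProductSpace.comp_rankOne]
  exact Submodule.subset_span ⟨(_, _), rfl⟩

/-- On a separable space every operator is the weak limit of a bounded sequence of operators of
finite rank. -/
theorem exists_tendsto_finiteRankOperators [TopologicalSpace.SeparableSpace H]
    (A : H →L[ℂ] H) : ∃ a : ℕ → H →L[ℂ] H, (∀ n, a n ∈ finiteRankOperators H) ∧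
      (∀ n, ‖a n‖ ≤ ‖A‖) ∧ ∀ x y, Tendsto (fun n => ⟪x, a n y⟫) atTop (𝓝 ⟪x, A y⟫) := by
  -- The projections onto the spans of the first n terms of a dense sequence increase strongly to 1.
  let U : ℕ → Submodule ℂ H := fun n =>
    Submodule.span ℂ (TopologicalSpace.denseSeq H '' Set.Iio n)
  have hfin : ∀ n, FiniteDimensional ℂ (U n) := fun n =>
    FiniteDimensional.span_of_finite ℂ ((Set.finite_Iio n).image _)
  have hmono : Monotone U := fun m n hmn =>
    Submodule.span_mono (Set.image_mono (Set.Iio_subset_Iio hmn))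
  have htop : ⊤ ≤ (⨆ n, U n).topologicalClosure := by
    rw [← SetLike.coe_subset_coe, Submodule.topologicalClosure_coe]
    intro x _
    refine closure_mono ?_ (TopologicalSpace.denseRange_denseSeq H x)
    rintro _ ⟨n, rfl⟩
    exact Submodule.mem_iSup_of_mem (n + 1)
      (Submodule.subset_span ⟨n, by simp, rfl⟩)
  refine ⟨fun n => A * (U n).starProjection,
    fun n => starProjection_mul_mem_finiteRankOperators (U n) A, fun n => ?_, fun x y => ?_⟩
  · calc _ ≤ ‖A‖ * ‖(U n).starProjection‖ := norm_mul_le _ _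
      _ ≤ ‖A‖ * 1 := by gcongr; exact Submodule.starProjection_norm_le _
      _ = ‖A‖ := mul_one _
  · exact tendsto_const_nhds.inner
      ((A.continuous.tendsto _).comp (Submodule.starProjection_tendsto_self U hmono y htop))

variable [CompleteSpace H] {G : Type*} [Group G] [TopologicalSpace G]
  {U : G →* unitary (H →L[ℂ] H)}

/-- A rank one operator |x⟩⟨y| moves to |Ux⟩⟨Uy|, which depends norm continuously on its two
vectors; strong continuity of U therefore suffices. -/
theorem continuous_conjAct_of_mem_finiteRankOperators
    (hU : ∀ x : H, Continuous fun g => (U g : H →L[ℂ] H) x) {A : H →L[ℂ] H}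
    (hA : A ∈ finiteRankOperators H) : Continuous fun g => conjAct U g A := by
  induction hA using Submodule.span_induction with
  | mem A h =>
    obtain ⟨⟨x, y⟩, rfl⟩ := h
    simp only [conjAct_rankOne]
    exact continuous_rankOne.comp ((hU x).prodMk (hU y))
  | zero => simpa [conjAct] using continuous_const
  | add A B _ _ h1 h2 => simp only [conjAct_add]; exact h1.add h2
  | smul c A _ h => simp only [conjAct_smul]; exact h.const_smul c

/-- Approximation of the orbit by simple functions needs an essentially separable range.
Separability of H provides it, so that G need not be second countable. -/
theorem stronglyMeasurable_conjAct_of_mem_finiteRankOperators [MeasurableSpace G] [BorelSpace G]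
    [TopologicalSpace.SeparableSpace H]
    (hU : ∀ x : H, Continuous fun g => (U g : H →L[ℂ] H) x) {A : H →L[ℂ] H}
    (hA : A ∈ finiteRankOperators H) : StronglyMeasurable fun g => conjAct U g A := by
  have : SecondCountableTopology H := UniformSpace.secondCountable_of_separable H
  induction hA using Submodule.span_induction with
  | mem A h =>
    obtain ⟨⟨x, y⟩, rfl⟩ := h
    simp only [conjAct_rankOne]
    exact continuous_rankOne.comp_stronglyMeasurable
      ((hU x).stronglyMeasurable.prodMk (hU y).stronglyMeasurable)
  | zero => simpa [conjAct] using stronglyMeasurable_const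
  | add A B _ _ h1 h2 => simp only [conjAct_add]; exact h1.add h2
  | smul c A _ h => simp only [conjAct_smul]; exact h.const_smul c

end FiniteRank

/-! ### Projection valued measures -/

section ProjectionValued

variable {Ω : Type*} [MeasurableSpace Ω] {H K : Type*} [NormedAddCommGroup H]
  [InnerProductSpace ℂ H] [NormedAddCommGroup K] [InnerProductSpace ℂ K]
  {F : POM Ω K}

/-- Idempotency of F(X) + F(Y) makes P = F(X) and Q = F(Y) anticommute. Then PQ = P(PQ) = -PQP = QPP
= QP = -PQ, so PQ = 0. -/
theorem POM.IsProjectionValued.mul_of_disjoint (hF : F.IsProjectionValued) {X Y : Set Ω}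
    (hX : MeasurableSet X) (hY : MeasurableSet Y) (h : Disjoint X Y) : F X * F Y = 0 := by
  have h1 := hF _ (hX.union hY)
  have hXX := hF _ hX
  have hYY := hF _ hY
  rw [F.map_union hX hY h, add_mul, mul_add, mul_add, hXX, hYY] at h1
  have h2 : F X * F Y + F Y * F X = 0 := by
    have : F X + F Y + (F X * F Y + F Y * F X) = F X + F Y :=
      Eq.trans (by abel) h1
    simpa using this
  have h3 : F Y * F X = -(F X * F Y) := eq_neg_of_add_eq_zero_right h2
  have h4 : F X * F Y = -(F X * F Y) := by
    calc F X * F Y = F X * (F X * F Y) := by rw [← mul_assoc, hXX]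
      _ = F X * -(F Y * F X) := by rw [h3, neg_neg]
      _ = -(F X * F Y) * F X := by rw [mul_neg, neg_mul, mul_assoc]
      _ = F Y * (F X * F X) := by rw [← h3, mul_assoc]
      _ = -(F X * F Y) := by rw [hXX, h3]
  have h5 : (2 : ℂ) • (F X * F Y) = 0 := by
    rw [two_smul]; nth_rewrite 1 [h4]; exact neg_add_cancel _
  exact (smul_eq_zero.1 h5).resolve_left two_ne_zero

theorem POM.IsProjectionValued.mul_of_subset (hF : F.IsProjectionValued) {X Y : Set Ω}
    (hX : MeasurableSet X) (hY : MeasurableSet Y) (h : Y ⊆ X) : F X * F Y = F Y := by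
  have h1 := F.map_union hY (hX.diff hY) Set.disjoint_sdiff_right
  rw [Set.union_sdiff_cancel h] at h1
  rw [h1, add_mul, hF _ hY, hF.mul_of_disjoint (hX.diff hY) hY Set.disjoint_sdiff_left, add_zero]

theorem SimpleFunc.apply_eq_sum_indicator (a : SimpleFunc Ω (H →L[ℂ] H)) (ω : Ω) :
    a ω = ∑ A ∈ a.range, (a ⁻¹' {A}).indicator (fun _ => A) ω := by
  rw [Finset.sum_eq_single (a ω)]
  · simp
  · intro A _ hA
    exact Set.indicator_of_notMem (fun h => hA h.symm) _
  · simp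

theorem SimpleFunc.mul_eq_sum_indicator (a : SimpleFunc Ω (H →L[ℂ] H)) (b : Ω → H →L[ℂ] H)
    (ω : Ω) : a ω * b ω = ∑ A ∈ a.range, (a ⁻¹' {A}).indicator (fun ω => A * b ω) ω := by
  rw [SimpleFunc.apply_eq_sum_indicator a ω, Finset.sum_mul]
  exact Finset.sum_congr rfl fun A _ => by by_cases h : ω ∈ a ⁻¹' {A} <;> simp [h]

variable [Nonempty Ω] [CompleteSpace H] [CompleteSpace K]

/-- In a Riemann sum whose fibres lie inside V or outside it, multiplication by F(V) keeps the
former terms and kills the latter. Left multiplication by a fixed operator is weakly continuous, so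
the identity survives the limit. -/
theorem opTens_mul_weakIntegral (hF : F.IsProjectionValued) (A : H →L[ℂ] H) {V : Set Ω}
    (hV : MeasurableSet V) {b : Ω → H →L[ℂ] H} (hb : BddWeaklyMeasurable b) :
    opTens A (F V) * weakIntegral F b = weakIntegral F (V.indicator fun ω => A * b ω) := by
  refine ContinuousLinearMap.ext_inner_map fun x y => ?_
  rw [mul_apply_eq_comp, ← ContinuousLinearMap.adjoint_inner_left]
  refine tendsto_nhds_unique (tendsto_riemannSum F hb _ y) ?_
  refine (tendsto_riemannSum F ((hb.const_mul A).indicator hV) x y).congr' ?_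
  -- Restriction to tagged partitions that respect the partition of Ω into V and its complement.
  filter_upwards [eventually_tagFilter
    (SimpleFunc.piecewise V hV (SimpleFunc.const Ω 1) (SimpleFunc.const Ω 0))] with s hs
  rw [ContinuousLinearMap.adjoint_inner_left, ← mul_apply_eq_comp]
  congr 2
  rw [riemannSum, riemannSum, Finset.mul_sum]
  refine Finset.sum_congr rfl fun g hg => ?_
  obtain ⟨ω, rfl⟩ := SimpleFunc.mem_range.1 hg
  have hmem : ∀ ω, s ω ∈ V ↔ ω ∈ V := by
    intro ω
    have := hs ω
    by_cases h1 : s ω ∈ V <;> by_cases h2 : ω ∈ V <;> simp_all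
  have hfib := s.measurableSet_fiber (s ω)
  by_cases h : s ω ∈ V
  · rw [Set.indicator_of_mem h, opTens_mul, hF.mul_of_subset hV hfib fun ω' hω' => ?_]
    exact (hmem ω').1 (by rwa [show s ω' = s ω from hω'])
  · rw [Set.indicator_of_notMem h, opTens_mul, hF.mul_of_disjoint hV hfib, opTens_zero_left,
      opTens_zero_right]
    rw [Set.disjoint_right]
    intro ω' hω' hV'
    exact h (by rw [← show s ω' = s ω from hω']; exact (hmem ω').2 hV')

omit [Nonempty Ω] in
theorem bddWeaklyMeasurable_simpleFunc_mul (a : SimpleFunc Ω (H →L[ℂ] H)) {b : Ω → H →L[ℂ] H}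
    (hb : BddWeaklyMeasurable b) : BddWeaklyMeasurable fun ω => a ω * b ω := by
  simp only [SimpleFunc.mul_eq_sum_indicator]
  exact BddWeaklyMeasurable.sum _ fun A _ => (hb.const_mul A).indicator (a.measurableSet_fiber A)

theorem weakIntegral_simpleFunc_mul (hF : F.IsProjectionValued) (a : SimpleFunc Ω (H →L[ℂ] H))
    {b : Ω → H →L[ℂ] H} (hb : BddWeaklyMeasurable b) :
    weakIntegral F (fun ω => a ω * b ω) = weakIntegral F a * weakIntegral F b := by
  have ha : (a : Ω → H →L[ℂ] H) =
      fun ω => ∑ A ∈ a.range, (a ⁻¹' {A}).indicator (fun _ => A) ω :=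
    funext (SimpleFunc.apply_eq_sum_indicator a)
  have hf := a.measurableSet_fiber
  simp only [SimpleFunc.mul_eq_sum_indicator]
  rw [weakIntegral_sum F _ fun A _ => (hb.const_mul A).indicator (hf A)]
  conv_rhs => rw [ha]
  rw [weakIntegral_sum F _ fun A _ => (BddWeaklyMeasurable.const A).indicator (hf A),
    Finset.sum_mul]
  refine Finset.sum_congr rfl fun A _ => ?_
  rw [weakIntegral_indicator_const F A (hf A), opTens_mul_weakIntegral hF A (hf A) hb]

/-- Only a is approximated, by bounded simple functions converging pointwise in norm. Operator
multiplication is weakly continuous in each factor separately but not jointly, so b and its integral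
stay fixed. -/
theorem weakIntegral_mul (hF : F.IsProjectionValued) {a b : Ω → H →L[ℂ] H}
    (ha : StronglyMeasurable a) {C : ℝ} (hC : ∀ ω, ‖a ω‖ ≤ C) (hb : BddWeaklyMeasurable b) :
    weakIntegral F (fun ω => a ω * b ω) = weakIntegral F a * weakIntegral F b := by
  let f := ha.approxBounded C
  have hfC : ∀ n ω, ‖f n ω‖ ≤ C := ha.norm_approxBounded_le (nonneg_of_norm_le hC)
  have hlim : ∀ ω, Tendsto (fun n => f n ω) atTop (𝓝 (a ω)) := fun ω =>
    ha.tendsto_approxBounded_of_norm_le (hC ω)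
  have hlim' : ∀ ω x y, Tendsto (fun n => ⟪x, f n ω y⟫) atTop (𝓝 ⟪x, a ω y⟫) := fun ω x y =>
    tendsto_const_nhds.inner
      (((ContinuousLinearMap.apply ℂ H y).continuous.tendsto _).comp (hlim ω))
  have hfm : ∀ n, BddWeaklyMeasurable (f n) := fun n => by
    simpa using bddWeaklyMeasurable_simpleFunc_mul (f n) (BddWeaklyMeasurable.const 1)
  have ham : BddWeaklyMeasurable a := BddWeaklyMeasurable.of_tendsto hfm hC hlim'
  obtain ⟨D, hD⟩ := hb.bdd
  have hCD : ∀ A ω, ‖A‖ ≤ C → ‖A * b ω‖ ≤ C * D := fun A ω hA =>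
    (norm_mul_le _ _).trans (mul_le_mul hA (hD ω) (norm_nonneg _) (nonneg_of_norm_le hC))
  have hmul : ∀ ω x y, Tendsto (fun n => ⟪x, (f n ω * b ω) y⟫) atTop (𝓝 ⟪x, (a ω * b ω) y⟫) :=
    fun ω x y => hlim' ω x (b ω y)
  have hfbm := fun n => bddWeaklyMeasurable_simpleFunc_mul (f n) hb
  have habm : BddWeaklyMeasurable fun ω => a ω * b ω :=
    BddWeaklyMeasurable.of_tendsto hfbm (fun ω => hCD _ ω (hC ω)) hmul
  refine ContinuousLinearMap.ext_inner_map fun x y => ?_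
  refine tendsto_nhds_unique
    (tendsto_weakIntegral F hfbm (fun n ω => hCD _ ω (hfC n ω)) habm hmul x y) ?_
  refine (tendsto_weakIntegral F hfm hfC ham hlim' x (weakIntegral F b y)).congr fun n => ?_
  rw [weakIntegral_simpleFunc_mul hF (f n) hb, mul_apply_eq_comp]

end ProjectionValued

/-! ### Multiplicativity of the relativisation for projection valued F -/

section RelativiseMul

variable {G : Type*} [Group G] [TopologicalSpace G] [IsTopologicalGroup G] [MeasurableSpace G]
  [BorelSpace G]
  {HS : Type*} [NormedAddCommGroup HS] [InnerProductSpace ℂ HS] [CompleteSpace HS]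
  {HR : Type*} [NormedAddCommGroup HR] [InnerProductSpace ℂ HR] [CompleteSpace HR]
  {US : G →* unitary (HS →L[ℂ] HS)} (hUS : ∀ x : HS, Continuous fun g => (US g : HS →L[ℂ] HS) x)
  {F : POM G HR}

include hUS

/-- The orbit of a general A need not be strongly measurable. So A is replaced by finite rank
operators, for which `weakIntegral_mul` applies; with B fixed both sides are weakly continuous in
the left factor. -/
theorem relativise_mul [TopologicalSpace.SeparableSpace HS] (hF : F.IsProjectionValued)
    (A B : HS →L[ℂ] HS) : relativise US F (A * B) = relativise US F A * relativise US F B := by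
  obtain ⟨a, ha, hbd, hlim⟩ := exists_tendsto_finiteRankOperators A
  have hmul : ∀ n, relativise US F (a n * B) = relativise US F (a n) * relativise US F B := by
    intro n
    simp only [relativise_eq_weakIntegral, conjAct_mul]
    exact weakIntegral_mul hF (stronglyMeasurable_conjAct_of_mem_finiteRankOperators hUS (ha n))
      (fun g => norm_conjAct_le US g (a n)) (bddWeaklyMeasurable_conjAct US hUS B)
  refine ContinuousLinearMap.ext_inner_map fun x y => ?_
  refine tendsto_nhds_unique (tendsto_relativise hUS F (C := ‖A‖ * ‖B‖) (a := fun n => a n * B)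
    (A := A * B) (fun n => ?_) (fun x y => hlim x (B y)) x y) ?_
  · exact (norm_mul_le _ _).trans (by gcongr; exact hbd n)
  · refine (tendsto_relativise hUS F hbd hlim x (relativise US F B y)).congr fun n => ?_
    rw [hmul, mul_apply_eq_comp]

theorem exists_starAlgHom_relativise [TopologicalSpace.SeparableSpace HS]
    (hF : F.IsProjectionValued) :
    ∃ Λ : (HS →L[ℂ] HS) →⋆ₐ[ℂ] (HilbertTensor HS HR →L[ℂ] HilbertTensor HS HR),
      ∀ A, Λ A = relativise US F A :=
  ⟨{ AlgHom.ofLinearMap (relativiseLinear hUS F) (relativise_one US F) (relativise_mul hUS hF) with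
      map_star' := relativise_star hUS F }, fun _ => rfl⟩

end RelativiseMul

/-! ### Haar measure on a compact group -/

section Haar

theorem BddWeaklyMeasurable.of_tens {Ω H K : Type*} [MeasurableSpace Ω] [NormedAddCommGroup H]
    [InnerProductSpace ℂ H] [NormedAddCommGroup K] [InnerProductSpace ℂ K]
    {M : Ω → HilbertTensor H K →L[ℂ] HilbertTensor H K} {C : ℝ} (hC : ∀ ω, ‖M ω‖ ≤ C)
    (h : ∀ φ η φ' η', Measurable fun ω => ⟪tens φ η, M ω (tens φ' η')⟫) :
    BddWeaklyMeasurable M := by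
  refine ⟨fun x y => ?_, C, hC⟩
  induction x using HilbertTensor.induction with
  | hc =>
    -- Sequences suffice in a metric space, and pointwise limits of sequences preserve
    -- measurability.
    refine IsSeqClosed.isClosed fun u z hu hz => ?_
    exact measurable_of_tendsto_metrizable hu
      (tendsto_pi_nhds.2 fun ω => hz.inner tendsto_const_nhds)
  | h0 => simp
  | ha x x' h1 h2 => simp only [inner_add_left]; exact h1.add h2
  | ht φ η =>
    induction y using HilbertTensor.induction with
    | hc =>
      refine IsSeqClosed.isClosed fun u z hu hz => ?_
      exact measurable_of_tendsto_metrizable hu (tendsto_pi_nhds.2 fun ω =>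
        tendsto_const_nhds.inner (((M ω).continuous.tendsto z).comp hz))
    | h0 => simp
    | ha y y' h1 h2 => simp only [map_add, inner_add_right]; exact h1.add h2
    | ht φ' η' => exact h φ η φ' η'

/-- All set integrals of c are values of a positive measure, which forces c ≥ 0 almost everywhere.
Thus no sign condition on κ is required later. -/
theorem POM.measure_eq_withDensity {Ω H : Type*} [MeasurableSpace Ω] [NormedAddCommGroup H]
    [InnerProductSpace ℂ H] (F : POM Ω H) (η : H) {μ : Measure Ω} {c : Ω → ℝ}
    (hc : Integrable c μ)
    (h : ∀ X, MeasurableSet X → (⟪η, F X η⟫).re = ∫ ω in X, c ω ∂μ) :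
    0 ≤ᵐ[μ] c ∧ F.measure η = μ.withDensity fun ω => ENNReal.ofReal (c ω) := by
  have h0 : 0 ≤ᵐ[μ] c := ae_nonneg_of_forall_setIntegral_nonneg hc fun X hX _ => by
    rw [← h X hX]
    exact (ContinuousLinearMap.nonneg_iff_inner.1 (F.nonneg' X hX) η).1
  refine ⟨h0, ?_⟩
  ext X hX
  rw [F.measure_apply η hX, withDensity_apply _ hX, h X hX,
    ofReal_integral_eq_lintegral_ofReal hc.integrableOn (ae_restrict_of_ae h0)]

variable {G : Type*} [Group G] [TopologicalSpace G] [IsTopologicalGroup G] [MeasurableSpace G]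
  [BorelSpace G]
  {HS : Type*} [NormedAddCommGroup HS] [InnerProductSpace ℂ HS] [CompleteSpace HS]
  {HR : Type*} [NormedAddCommGroup HR] [InnerProductSpace ℂ HR] [CompleteSpace HR]
  {US : G →* unitary (HS →L[ℂ] HS)} {UR : G →* unitary (HR →L[ℂ] HR)}

/-- The right-hand side is a bounded sesquilinear form, hence given by an operator B. On elementary
tensors the factor κ⟨η, α_g(T)η⟩ is the density of F's measure with respect to μ, so B satisfies the
defining equation and uniqueness applies. -/
theorem inner_relativise_eq_integral
    (hUS : ∀ x : HS, Continuous fun g => (US g : HS →L[ℂ] HS) x)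
    (hUR : ∀ x : HR, Continuous fun g => (UR g : HR →L[ℂ] HR) x) (F : POM G HR)
    (μ : Measure G) [IsFiniteMeasure μ] (κ : ℝ) {T : HR →L[ℂ] HR} (hT : 0 ≤ T)
    (hF : ∀ X, MeasurableSet X → ∀ η η' : HR,
      ⟪η, F X η'⟫ = κ * ∫ g in X, ⟪η, conjAct UR g T η'⟫ ∂μ)
    (A : HS →L[ℂ] HS) (Φ Ψ : HilbertTensor HS HR) :
    ⟪Φ, relativise US F A Ψ⟫ =
      κ * ∫ g, ⟪Φ, opTens (conjAct US g A) (conjAct UR g T) Ψ⟫ ∂μ := by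
  have hM : BddWeaklyMeasurable fun g => opTens (conjAct US g A) (conjAct UR g T) :=
    .of_tens (C := ‖A‖ * ‖T‖) (fun g => (norm_opTens_le _ _).trans
      (mul_le_mul (norm_conjAct_le US g A) (norm_conjAct_le UR g T) (norm_nonneg _)
        (norm_nonneg _))) fun φ η φ' η' => by
      simp only [opTens_tens, inner_tens]
      exact ((continuous_inner_conjAct US hUS A φ φ').mul
        (continuous_inner_conjAct UR hUR T η η')).measurable
  obtain ⟨C, hC⟩ := hM.bdd
  obtain ⟨B, hB⟩ := exists_operator_of_form
    (fun Φ Ψ : HilbertTensor HS HR =>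
      κ * ∫ g, ⟪Φ, opTens (conjAct US g A) (conjAct UR g T) Ψ⟫ ∂μ)
    (|κ| * (C * μ.real Set.univ))
    (fun x y z => by
      simp only [map_add, inner_add_right]
      rw [integral_add (hM.integrable μ x y) (hM.integrable μ x z), mul_add])
    (fun x c y => by
      simp only [map_smul, inner_smul_right, integral_const_mul]; ring)
    (fun x y z => by
      simp only [inner_add_left]
      rw [integral_add (hM.integrable μ x z) (hM.integrable μ y z), mul_add])
    (fun c x y => by
      simp only [inner_smul_left, integral_const_mul]; ring)
    (fun x y => by
      have := norm_integral_le_of_norm_le_const (μ := μ) (C := C * ‖x‖ * ‖y‖)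
        (ae_of_all _ fun g => norm_inner_apply_le_of_le (hC g) x y)
      rw [norm_mul, Complex.norm_real, Real.norm_eq_abs]
      calc _ ≤ |κ| * (C * ‖x‖ * ‖y‖ * μ.real Set.univ) := by gcongr
        _ = _ := by ring)
  suffices IsRelativisation US F A B by
    rw [IsWeakIntegral.unique (isRelativisation_relativise hUS F A) this, hB]
  intro φ φ' η
  have hreal : ∀ g, ⟪η, conjAct UR g T η⟫ = ((⟪η, conjAct UR g T η⟫).re : ℂ) := fun g =>
    Complex.ext rfl
      (ContinuousLinearMap.nonneg_iff_inner.1 (conjAct_nonneg UR g hT) η).2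
  have hcont := continuous_inner_conjAct UR hUR T η η
  have hcm : Measurable fun g => κ * (⟪η, conjAct UR g T η⟫).re :=
    (continuous_const.mul (Complex.continuous_re.comp hcont)).measurable
  have hci : Integrable (fun g => κ * (⟪η, conjAct UR g T η⟫).re) μ :=
    (((bddWeaklyMeasurable_conjAct UR hUR T).integrable μ η η).re).const_mul κ
  obtain ⟨h0, hden⟩ := F.measure_eq_withDensity η hci fun X hX => by
    have h1 : ∀ X, ∫ g in X, ⟪η, conjAct UR g T η⟫ ∂μ =
        ((∫ g in X, (⟪η, conjAct UR g T η⟫).re ∂μ : ℝ) : ℂ) := fun X => by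
      refine (integral_congr_ae (ae_of_all _ fun g => hreal g)).trans ?_
      exact integral_ofReal
    rw [hF X hX, h1, ← Complex.ofReal_mul, Complex.ofReal_re, integral_const_mul]
  rw [hB, hden, integral_withDensity_eq_integral_toReal_smul hcm.ennreal_ofReal
    (ae_of_all _ fun _ => ENNReal.ofReal_lt_top), ← integral_const_mul]
  refine integral_congr_ae ?_
  filter_upwards [h0] with g hg
  rw [ENNReal.toReal_ofReal hg, opTens_tens, inner_tens, hreal g, Complex.real_smul]
  push_cast
  rw [Complex.ofReal_re]
  ring

end Haar

/-! ### Trace class operators -/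

section TraceClass

variable {H : Type*} [NormedAddCommGroup H] [InnerProductSpace ℂ H]

theorem HilbertBasis.hasSum_norm_inner_sq {ι : Type*} (b : HilbertBasis ι ℂ H) (x : H) :
    HasSum (fun i => ‖⟪b i, x⟫‖ ^ 2) (‖x‖ ^ 2) := by
  have h := Complex.hasSum_re (b.hasSum_inner_mul_inner x x)
  rw [inner_self_eq_ofReal, Complex.ofReal_re] at h
  refine h.congr_fun fun i => ?_
  rw [← inner_conj_symm x (b i), mul_comm, Complex.mul_conj, Complex.ofReal_re,
    Complex.normSq_eq_norm_sq]

variable [CompleteSpace H]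

/-- Douglas factorisation. -/
theorem exists_mul_eq_of_norm_le {S T : H →L[ℂ] H} (h : ∀ x, ‖S x‖ ≤ ‖T x‖) :
    ∃ V : H →L[ℂ] H, ‖V‖ ≤ 1 ∧ V * T = S := by
  -- V sends Tx to Sx, is extended by continuity to the closure of the range, and vanishes on its
  -- orthogonal complement.
  let M := (LinearMap.range T.toLinearMap).topologicalClosure
  have hmem : ∀ x, T x ∈ M := fun x => Submodule.le_topologicalClosure _ ⟨x, rfl⟩
  let e : H →ₗ[ℂ] M := T.toLinearMap.codRestrict M hmem
  have hdense : DenseRange e := by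
    intro y
    rw [closure_subtype]
    have hy : (y : H) ∈ closure (LinearMap.range T.toLinearMap : Set H) := y.2
    refine closure_mono ?_ hy
    rintro _ ⟨x, rfl⟩
    exact ⟨e x, ⟨x, rfl⟩, rfl⟩
  have hnorm : ∀ x, ‖S.toLinearMap x‖ ≤ 1 * ‖e x‖ := fun x => by
    rw [one_mul]; exact h x
  refine ⟨(S.toLinearMap.extendOfNorm e).comp M.orthogonalProjectionOnto, ?_, ?_⟩
  · calc _ ≤ ‖S.toLinearMap.extendOfNorm e‖ * ‖M.orthogonalProjectionOnto‖ :=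
          ContinuousLinearMap.opNorm_comp_le _ _
      _ ≤ 1 * 1 := by
          gcongr
          · exact LinearMap.opNorm_extendOfNorm_le hdense zero_le_one hnorm
          · exact M.orthogonalProjectionOnto_norm_le
      _ = 1 := one_mul 1
  · ext x
    have h1 : M.orthogonalProjectionOnto (T x) = e x :=
      Submodule.orthogonalProjectionOnto_mem_subspace_eq_self (e x)
    rw [mul_apply_eq_comp, ContinuousLinearMap.comp_apply, h1]
    exact LinearMap.extendOfNorm_eq hdense ⟨1, hnorm⟩ x

theorem norm_cfcAbs_apply (T : H →L[ℂ] H) (x : H) : ‖CFC.abs T x‖ = ‖T x‖ := by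
  have h : ((‖CFC.abs T x‖ ^ 2 : ℝ) : ℂ) = ((‖T x‖ ^ 2 : ℝ) : ℂ) := by
    rw [← inner_self_eq_ofReal, ← inner_self_eq_ofReal, ← ContinuousLinearMap.adjoint_inner_right,
      ← ContinuousLinearMap.adjoint_inner_right, ← ContinuousLinearMap.star_eq_adjoint,
      ← ContinuousLinearMap.star_eq_adjoint, (CFC.abs_nonneg T).isSelfAdjoint.star_eq,
      ← mul_apply_eq_comp, ← mul_apply_eq_comp, CFC.abs_mul_abs]
  exact (sq_eq_sq₀ (norm_nonneg _) (norm_nonneg _)).1 (by exact_mod_cast h)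

omit [CompleteSpace H] in
theorem summable_prod_norm_inner_sq {ι κ : Type*} (b : HilbertBasis ι ℂ H) {z : κ → H}
    (hz : Summable fun j => ‖z j‖ ^ 2) : Summable fun p : κ × ι => ‖⟪b p.2, z p.1⟫‖ ^ 2 := by
  rw [summable_prod_of_nonneg fun _ => by positivity]
  refine ⟨fun j => (b.hasSum_norm_inner_sq (z j)).summable, ?_⟩
  simpa only [(b.hasSum_norm_inner_sq _).tsum_eq] using hz

/-- The trace of `W Q Q B` is that of `Q B W Q` for a self-adjoint Hilbert–Schmidt operator `Q`. -/
theorem exists_hasSum_of_summable {ι : Type*} (e : HilbertBasis ι ℂ H) {Q : H →L[ℂ] H}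
    (hQ : ContinuousLinearMap.adjoint Q = Q) (hQs : Summable fun j => ‖Q (e j)‖ ^ 2)
    (W B : H →L[ℂ] H) : ∃ τ, HasSum (fun i => ⟪e i, W (Q (Q (B (e i))))⟫) τ ∧
      HasSum (fun j => ⟪Q (e j), B (W (Q (e j)))⟫) τ := by
  have hsum : ∀ V : H →L[ℂ] H, Summable fun p : ι × ι => ‖⟪e p.2, V (Q (e p.1))⟫‖ ^ 2 := fun V =>
    summable_prod_norm_inner_sq e (z := fun j => V (Q (e j)))
      ((hQs.mul_left (‖V‖ ^ 2)).of_nonneg_of_le (fun _ => by positivity) fun j => by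
        rw [← mul_pow]; gcongr; exact V.le_opNorm _)
  -- The double family is a product of two square summable matrices, hence absolutely summable.
  -- Summing over one index first gives one trace formula, over the other index the second.
  have huv : Summable fun p : ι × ι =>
      ⟪ContinuousLinearMap.adjoint B (Q (e p.1)), e p.2⟫ * ⟪e p.2, W (Q (e p.1))⟫ := by
    refine Summable.of_norm_bounded
      ((hsum W).add (hsum (ContinuousLinearMap.adjoint B))) fun p => ?_
    rw [norm_mul, norm_inner_symm, mul_comm]
    generalize ‖⟪e p.2, W (Q (e p.1))⟫‖ = r
    generalize ‖⟪e p.2, ContinuousLinearMap.adjoint B (Q (e p.1))⟫‖ = s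
    nlinarith [sq_nonneg (r - s), sq_nonneg r, sq_nonneg s]
  obtain ⟨τ, hτ⟩ := huv
  refine ⟨τ, ((Equiv.prodComm _ _).hasSum_iff.2 hτ).prod_fiberwise fun i => ?_,
    hτ.prod_fiberwise fun j => ?_⟩
  · have h := e.hasSum_inner_mul_inner (Q (ContinuousLinearMap.adjoint W (e i))) (Q (B (e i)))
    have h0 : ∀ x y, ⟪Q x, y⟫ = ⟪x, Q y⟫ := fun x y => by
      rw [← ContinuousLinearMap.adjoint_inner_left, hQ]
    rw [h0, ContinuousLinearMap.adjoint_inner_left] at h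
    refine h.congr_fun fun j => ?_
    change ⟪ContinuousLinearMap.adjoint B (Q (e j)), e i⟫ * ⟪e i, W (Q (e j))⟫ = _
    rw [ContinuousLinearMap.adjoint_inner_left, h0, h0, ContinuousLinearMap.adjoint_inner_left,
      mul_comm]
  · rw [← ContinuousLinearMap.adjoint_inner_left]
    exact e.hasSum_inner_mul_inner (ContinuousLinearMap.adjoint B (Q (e j))) (W (Q (e j)))

/-- The trace of `R B` as a sum of matrix elements of `B`. -/
theorem IsTraceClass.exists_hasSum {R : H →L[ℂ] H} (hR : IsTraceClass R) :
    ∃ x y : stdIndex H → H, (HasSum (fun j => ‖x j‖ ^ 2) (traceNorm R)) ∧ (∀ j, ‖y j‖ ≤ ‖x j‖) ∧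
      ∀ B : H →L[ℂ] H,
        HasSum (fun i => ⟪stdBasis H i, (R * B) (stdBasis H i)⟫) (opTrace (R * B)) ∧
        HasSum (fun j => ⟪x j, B (y j)⟫) (opTrace (R * B)) := by
  -- Douglas factorisation stands in for the polar decomposition: R = W|R| = W Q Q with W a
  -- contraction and Q = |R|^(1/2) Hilbert–Schmidt. The vectors are xⱼ = Q eⱼ and yⱼ = W Q eⱼ.
  obtain ⟨W, hW, hWR⟩ := exists_mul_eq_of_norm_le (S := R) (T := CFC.abs R)
    fun x => (norm_cfcAbs_apply R x).ge
  obtain ⟨Q, hQ0, hQQ⟩ : ∃ Q : H →L[ℂ] H, 0 ≤ Q ∧ Q * Q = CFC.abs R :=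
    ⟨_, CFC.sqrt_nonneg _, CFC.sqrt_mul_sqrt_self _ (CFC.abs_nonneg R)⟩
  have hQ : ContinuousLinearMap.adjoint Q = Q := hQ0.isSelfAdjoint.star_eq
  have hQsum : HasSum (fun j => ‖Q (stdBasis H j)‖ ^ 2) (traceNorm R) := by
    refine HasSum.congr_fun (Summable.hasSum hR) fun j => ?_
    rw [← hQQ, mul_apply_eq_comp, ← ContinuousLinearMap.adjoint_inner_left, hQ,
      inner_self_eq_ofReal, Complex.ofReal_re]
  refine ⟨fun j => Q (stdBasis H j), fun j => W (Q (stdBasis H j)), hQsum,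
    fun j => by simpa using W.le_of_opNorm_le hW (Q (stdBasis H j)), fun B => ?_⟩
  obtain ⟨τ, h1, h2⟩ := exists_hasSum_of_summable (stdBasis H) hQ hQsum.summable W B
  have h3 : HasSum (fun i => ⟪stdBasis H i, (R * B) (stdBasis H i)⟫) τ := by
    rw [← hWR, ← hQQ]
    exact h1
  have h4 : opTrace (R * B) = τ := h3.tsum_eq
  rw [h4]
  exact ⟨h3, h2⟩

theorem IsTraceClass.norm_opTrace_mul_le {R : H →L[ℂ] H} (hR : IsTraceClass R) (B : H →L[ℂ] H) :
    ‖opTrace (R * B)‖ ≤ ‖B‖ * traceNorm R := by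
  obtain ⟨x, y, hx, hy, hB⟩ := hR.exists_hasSum
  refine (hB B).2.norm_le_of_bounded (hx.mul_left ‖B‖) fun j => ?_
  refine (norm_inner_apply_le B _ _).trans ?_
  rw [sq, ← mul_assoc]
  gcongr
  exact hy j

theorem IsTraceClass.opTrace_mul_add {R : H →L[ℂ] H} (hR : IsTraceClass R) (B B' : H →L[ℂ] H) :
    opTrace (R * (B + B')) = opTrace (R * B) + opTrace (R * B') := by
  obtain ⟨x, y, hx, hy, hB⟩ := hR.exists_hasSum
  refine (hB (B + B')).1.unique (((hB B).1.add (hB B').1).congr_fun fun i => ?_)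
  simp [mul_add]

theorem IsTraceClass.opTrace_add_mul {R R' : H →L[ℂ] H} (hR : IsTraceClass R)
    (hR' : IsTraceClass R') (B : H →L[ℂ] H) :
    opTrace ((R + R') * B) = opTrace (R * B) + opTrace (R' * B) := by
  obtain ⟨x, y, hx, hy, hB⟩ := hR.exists_hasSum
  obtain ⟨x', y', hx', hy', hB'⟩ := hR'.exists_hasSum
  refine HasSum.tsum_eq (((hB B).1.add (hB' B).1).congr_fun fun i => ?_)
  simp [add_mul]

theorem opTrace_smul (c : ℂ) (R : H →L[ℂ] H) : opTrace (c • R) = c * opTrace R := by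
  simp [opTrace, tsum_mul_left]

theorem opTrace_mul_rankOne (R : H →L[ℂ] H) (x y : H) :
    opTrace (R * InnerProductSpace.rankOne ℂ x y) = ⟪y, R x⟫ := by
  refine HasSum.tsum_eq (((stdBasis H).hasSum_inner_mul_inner y (R x)).congr_fun fun i => ?_)
  simp

theorem opTrace_rankOne_mul (B : H →L[ℂ] H) (x y : H) :
    opTrace (InnerProductSpace.rankOne ℂ x y * B) = ⟪y, B x⟫ := by
  rw [← ContinuousLinearMap.adjoint_inner_left]
  refine HasSum.tsum_eq (((stdBasis H).hasSum_inner_mul_inner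
    (ContinuousLinearMap.adjoint B y) x).congr_fun fun i => ?_)
  rw [ContinuousLinearMap.adjoint_inner_left]
  simp

/-- Bounded weak convergence implies convergence of the traces. -/
theorem IsTraceClass.tendsto_opTrace {R : H →L[ℂ] H} (hR : IsTraceClass R) {ι : Type*}
    {l : Filter ι} {a : ι → H →L[ℂ] H} {A : H →L[ℂ] H} {C : ℝ} (hC : ∀ᶠ n in l, ‖a n‖ ≤ C)
    (h : ∀ x y, Tendsto (fun n => ⟪x, a n y⟫) l (𝓝 ⟪x, A y⟫)) :
    Tendsto (fun n => opTrace (R * a n)) l (𝓝 (opTrace (R * A))) := by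
  obtain ⟨x, y, hx, hy, hB⟩ := hR.exists_hasSum
  simp only [← (hB _).2.tsum_eq]
  refine tendsto_tsum_of_dominated_convergence (bound := fun j => |C| * ‖x j‖ ^ 2)
    (hx.summable.mul_left _) (fun j => h _ _) ?_
  filter_upwards [hC] with n hn j
  refine (norm_inner_apply_le_of_le (hn.trans (le_abs_self C)) _ _).trans ?_
  rw [sq, ← mul_assoc]
  gcongr
  exact hy j

/-- Since |T| = VT for some contraction V, the partial sums of the trace norm are among the sums
that the hypothesis bounds. -/
theorem isTraceClass_of_bound {T : H →L[ℂ] H} {C : ℝ}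
    (h : ∀ (I : Finset (stdIndex H)) (V : H →L[ℂ] H), ‖V‖ ≤ 1 →
      ‖∑ i ∈ I, ⟪stdBasis H i, V (T (stdBasis H i))⟫‖ ≤ C) :
    IsTraceClass T ∧ traceNorm T ≤ C := by
  obtain ⟨V, hV, hVT⟩ := exists_mul_eq_of_norm_le (S := CFC.abs T) (T := T)
    fun x => (norm_cfcAbs_apply T x).le
  have h0 : 0 ≤ fun i => (⟪stdBasis H i, CFC.abs T (stdBasis H i)⟫).re := fun i =>
    (ContinuousLinearMap.nonneg_iff_inner.1 (CFC.abs_nonneg T) _).1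
  have h1 : ∀ I : Finset (stdIndex H),
      ∑ i ∈ I, (⟪stdBasis H i, CFC.abs T (stdBasis H i)⟫).re ≤ C := by
    intro I
    rw [← hVT, ← Complex.re_sum]
    exact (Complex.re_le_norm _).trans (h I V hV)
  exact ⟨summable_of_sum_le h0 h1, Real.tsum_le_of_sum_le h0 h1⟩

omit [CompleteSpace H] in
theorem norm_sum_inner_mul_inner_le {ι : Type*} {v : ι → H} (hv : Orthonormal ℂ v) (I : Finset ι)
    (x y : H) : ‖∑ i ∈ I, ⟪x, v i⟫ * ⟪v i, y⟫‖ ≤ ‖x‖ * ‖y‖ := by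
  calc _ ≤ ∑ i ∈ I, ‖⟪v i, x⟫‖ * ‖⟪v i, y⟫‖ := (norm_sum_le _ _).trans_eq
        (Finset.sum_congr rfl fun i _ => by rw [norm_mul, norm_inner_symm])
    _ ≤ ‖x‖ * ‖y‖ := by
        refine (abs_le_of_sq_le_sq' ?_ (by positivity)).2
        calc _ ≤ _ := Finset.sum_mul_sq_le_sq_mul_sq _ _ _
          _ ≤ ‖x‖ ^ 2 * ‖y‖ ^ 2 := by
            gcongr
            · exact hv.sum_inner_products_le x
            · exact hv.sum_inner_products_le y
          _ = _ := by ring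

theorem isTraceClass_rankOne_self (x : H) : IsTraceClass (InnerProductSpace.rankOne ℂ x x) := by
  refine (isTraceClass_of_bound (C := ‖x‖ * ‖x‖) fun I V hV => ?_).1
  have := norm_sum_inner_mul_inner_le (stdBasis H).orthonormal I x (V x)
  simp only [InnerProductSpace.rankOne_apply, map_smul, inner_smul_right]
  refine this.trans ?_
  gcongr
  simpa using V.le_of_opNorm_le hV x

/-- The sum is P V, with P the projection onto the span of the vᵢ, i ∈ I. -/
theorem norm_sum_rankOne_le {ι : Type*} {v : ι → H} (hv : Orthonormal ℂ v) (I : Finset ι)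
    {V : H →L[ℂ] H} (hV : ‖V‖ ≤ 1) :
    ‖∑ i ∈ I, InnerProductSpace.rankOne ℂ (v i) (ContinuousLinearMap.adjoint V (v i))‖ ≤ 1 := by
  refine ContinuousLinearMap.opNorm_le_of_inner zero_le_one fun x y => ?_
  have := norm_sum_inner_mul_inner_le hv I x (V y)
  simp only [sum_apply, inner_sum, InnerProductSpace.rankOne_apply, inner_smul_right,
    ContinuousLinearMap.adjoint_inner_left]
  simp only [mul_comm (⟪v _, V y⟫)]
  refine this.trans ?_
  rw [one_mul]
  gcongr
  simpa using V.le_of_opNorm_le hV y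

end TraceClass

/-! ### Preduals and normality -/

section Predual

variable {H K : Type*} [NormedAddCommGroup H] [InnerProductSpace ℂ H] [CompleteSpace H]
  [NormedAddCommGroup K] [InnerProductSpace ℂ K] [CompleteSpace K]
  {Λ : (H →L[ℂ] H) →ₗ[ℂ] (K →L[ℂ] K)}

theorem eq_of_opTrace_mul_eq {S T : H →L[ℂ] H}
    (h : ∀ A : H →L[ℂ] H, opTrace (S * A) = opTrace (T * A)) : S = T :=
  ContinuousLinearMap.ext_inner_map fun x y => by
    rw [← opTrace_mul_rankOne, h, opTrace_mul_rankOne]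

/-- T is read off from rank one operators: ⟨x, T y⟩ = tr[R Λ(|y⟩⟨x|)]. Its trace-norm sums are
values of the bounded functional A ↦ tr[R Λ(A)] at finite rank contractions, so T is trace class.
The identity holds on finite rank operators by linearity, and in general by weak continuity along
bounded sequences. -/
theorem exists_predual_apply [TopologicalSpace.SeparableSpace H] (hΛ : ∀ A, ‖Λ A‖ ≤ ‖A‖)
    (hw : ∀ (A : H →L[ℂ] H) (a : ℕ → H →L[ℂ] H), (∀ n, ‖a n‖ ≤ ‖A‖) →
      (∀ x y, Tendsto (fun n => ⟪x, a n y⟫) atTop (𝓝 ⟪x, A y⟫)) →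
      ∀ x y, Tendsto (fun n => ⟪x, Λ (a n) y⟫) atTop (𝓝 ⟪x, Λ A y⟫))
    {R : K →L[ℂ] K} (hR : IsTraceClass R) :
    ∃ T : H →L[ℂ] H, IsTraceClass T ∧ traceNorm T ≤ traceNorm R ∧
      ∀ A, opTrace (R * Λ A) = opTrace (T * A) := by
  have hadd : ∀ A B, opTrace (R * Λ (A + B)) = opTrace (R * Λ A) + opTrace (R * Λ B) :=
    fun A B => by rw [map_add, hR.opTrace_mul_add]
  have hsmul : ∀ (c : ℂ) A, opTrace (R * Λ (c • A)) = c * opTrace (R * Λ A) := fun c A => by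
    rw [map_smul, mul_smul_comm, opTrace_smul]
  have hR0 : 0 ≤ traceNorm R := tsum_nonneg fun i =>
    (ContinuousLinearMap.nonneg_iff_inner.1 (CFC.abs_nonneg R) _).1
  have hbound : ∀ A, ‖opTrace (R * Λ A)‖ ≤ traceNorm R * ‖A‖ := fun A => by
    refine (hR.norm_opTrace_mul_le _).trans ?_
    rw [mul_comm]
    gcongr
    exact hΛ A
  obtain ⟨T, hT⟩ := exists_operator_of_form
    (fun x y : H => opTrace (R * Λ (InnerProductSpace.rankOne ℂ y x))) (traceNorm R)
    (fun x y z => by rw [map_add (InnerProductSpace.rankOne ℂ), add_apply, hadd])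
    (fun x c y => by rw [map_smul (InnerProductSpace.rankOne ℂ), smul_apply, hsmul])
    (fun x y z => by rw [map_add (InnerProductSpace.rankOne ℂ z), hadd])
    (fun c x y => by rw [map_smulₛₗ (InnerProductSpace.rankOne ℂ y), hsmul])
    (fun x y => by
      refine (hbound _).trans_eq ?_
      rw [InnerProductSpace.norm_rankOne]; ring)
  have hfin : ∀ A ∈ finiteRankOperators H, ∀ S : H →L[ℂ] H, IsTraceClass S →
      (∀ x y, opTrace (S * InnerProductSpace.rankOne ℂ y x) =
        opTrace (R * Λ (InnerProductSpace.rankOne ℂ y x))) →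
      opTrace (R * Λ A) = opTrace (S * A) := by
    intro A hA S hS h
    induction hA using Submodule.span_induction with
    | mem A hA =>
      obtain ⟨⟨y, x⟩, rfl⟩ := hA
      exact (h x y).symm
    | zero => simp [opTrace]
    | add A B _ _ h1 h2 => rw [hadd, hS.opTrace_mul_add, h1, h2]
    | smul c A _ h1 => rw [hsmul, mul_smul_comm, opTrace_smul, h1]
  have htr := isTraceClass_of_bound (T := T) (C := traceNorm R) fun I V hV => by
    simp only [← ContinuousLinearMap.adjoint_inner_left V, hT]
    have hsum : ∀ (I : Finset (stdIndex H)) (f : stdIndex H → H →L[ℂ] H),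
        ∑ i ∈ I, opTrace (R * Λ (f i)) = opTrace (R * Λ (∑ i ∈ I, f i)) := by
      classical
      intro I f
      induction I using Finset.induction_on with
      | empty => simp [opTrace]
      | insert i I hi ih => rw [Finset.sum_insert hi, Finset.sum_insert hi, hadd, ih]
    rw [hsum]
    refine (hbound _).trans (mul_le_of_le_one_right hR0 ?_)
    exact norm_sum_rankOne_le (stdBasis H).orthonormal I hV
  refine ⟨T, htr.1, htr.2, fun A => ?_⟩
  obtain ⟨a, ha, hbd, hlim⟩ := exists_tendsto_finiteRankOperators A
  have h1 := hR.tendsto_opTrace (a := fun n => Λ (a n)) (A := Λ A) (l := atTop) (C := ‖A‖)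
    (Eventually.of_forall fun n => (hΛ _).trans (hbd n)) (hw A a hbd hlim)
  have h2 := htr.1.tendsto_opTrace (Eventually.of_forall hbd) hlim
  refine tendsto_nhds_unique h1 (h2.congr fun n => ?_)
  refine (hfin _ (ha n) T htr.1 fun x y => ?_).symm
  rw [opTrace_mul_rankOne, hT]

theorem exists_predual [TopologicalSpace.SeparableSpace H] (hΛ : ∀ A, ‖Λ A‖ ≤ ‖A‖)
    (hw : ∀ (A : H →L[ℂ] H) (a : ℕ → H →L[ℂ] H), (∀ n, ‖a n‖ ≤ ‖A‖) →
      (∀ x y, Tendsto (fun n => ⟪x, a n y⟫) atTop (𝓝 ⟪x, A y⟫)) →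
      ∀ x y, Tendsto (fun n => ⟪x, Λ (a n) y⟫) atTop (𝓝 ⟪x, Λ A y⟫)) :
    ∃ P : (K →L[ℂ] K) → (H →L[ℂ] H),
      (∀ R, IsTraceClass R → IsTraceClass (P R)) ∧
      (∀ R R', IsTraceClass R → IsTraceClass R' → P (R + R') = P R + P R') ∧
      (∀ (c : ℂ) (R), IsTraceClass R → P (c • R) = c • P R) ∧
      (∃ C : ℝ, ∀ R, IsTraceClass R → traceNorm (P R) ≤ C * traceNorm R) ∧
      (∀ R, IsTraceClass R → ∀ A : H →L[ℂ] H, opTrace (R * Λ A) = opTrace (P R * A)) ∧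
      (∀ R, IsTraceClass R → ∀ S : H →L[ℂ] H, IsTraceClass S →
        (∀ A : H →L[ℂ] H, opTrace (R * Λ A) = opTrace (S * A)) → S = P R) := by
  classical
  -- T is determined by its traces against rank one operators, so the choice is forced wherever such
  -- a T exists. Linearity of P on the trace class then follows from uniqueness; the value 0
  -- elsewhere is arbitrary.
  let P : (K →L[ℂ] K) → (H →L[ℂ] H) := fun R =>
    if h : ∃ T : H →L[ℂ] H, ∀ A, opTrace (R * Λ A) = opTrace (T * A) then h.choose else 0
  have hP : ∀ R T, (∀ A, opTrace (R * Λ A) = opTrace (T * A)) → P R = T := by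
    intro R T hT
    have h : ∃ T : H →L[ℂ] H, ∀ A, opTrace (R * Λ A) = opTrace (T * A) := ⟨T, hT⟩
    simp only [P, dif_pos h]
    exact eq_of_opTrace_mul_eq fun A => by rw [← h.choose_spec, hT]
  have hspec : ∀ R, IsTraceClass R → IsTraceClass (P R) ∧ traceNorm (P R) ≤ traceNorm R ∧
      ∀ A, opTrace (R * Λ A) = opTrace (P R * A) := by
    intro R hR
    obtain ⟨T, h1, h2, h3⟩ := exists_predual_apply hΛ hw hR
    rw [hP R T h3]
    exact ⟨h1, h2, h3⟩
  refine ⟨P, fun R hR => (hspec R hR).1, fun R R' hR hR' => hP _ _ fun A => ?_,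
    fun c R hR => hP _ _ fun A => ?_, ⟨1, fun R hR => by simpa using (hspec R hR).2.1⟩,
    fun R hR => (hspec R hR).2.2, fun R _ S _ h => (hP R S h).symm⟩
  · rw [hR.opTrace_add_mul hR', (hspec R hR).1.opTrace_add_mul (hspec R' hR').1,
      (hspec R hR).2.2, (hspec R' hR').2.2]
  · rw [smul_mul_assoc, smul_mul_assoc, opTrace_smul, opTrace_smul, (hspec R hR).2.2]

/-- The supremum of an increasing net is its weak limit (along some ultrafilter). -/
theorem exists_tendsto_of_isLUB {D : Set (H →L[ℂ] H)} {A : H →L[ℂ] H} (hne : D.Nonempty)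
    (hdir : DirectedOn (· ≤ ·) D) (hA : IsLUB D A) :
    ∃ (u : Ultrafilter D) (C : ℝ), (∀ᶠ d : D in u, ‖(d : H →L[ℂ] H)‖ ≤ C) ∧
      ∀ x y, Tendsto (fun d : D => ⟪x, (d : H →L[ℂ] H) y⟫) u (𝓝 ⟪x, A y⟫) := by
  have : Nonempty D := hne.to_subtype
  have : IsDirectedOrder D := ⟨hdir.directed_val⟩
  obtain ⟨d₀, hd₀⟩ := hne
  let u := Ultrafilter.of (atTop : Filter D)
  have hu : ∀ d : D, ∀ᶠ d' : D in u, (d : H →L[ℂ] H) ≤ d' := fun d =>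
    Ultrafilter.of_le _ (eventually_ge_atTop d)
  -- An increasing net need not be norm bounded, but its tail above d₀ is, because 0 ≤ d - d₀ ≤ A -
  -- d₀ there.
  have hC : ∀ᶠ d : D in u, ‖(d : H →L[ℂ] H)‖ ≤ ‖A - d₀‖ + ‖d₀‖ := by
    filter_upwards [hu ⟨d₀, hd₀⟩] with d hd
    have h1 : ‖(d : H →L[ℂ] H) - d₀‖ ≤ ‖A - d₀‖ :=
      CStarAlgebra.norm_le_norm_of_nonneg_of_le (sub_nonneg.2 hd)
        (sub_le_sub_right (hA.1 d.2) d₀)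
    calc ‖(d : H →L[ℂ] H)‖ = ‖((d : H →L[ℂ] H) - d₀) + d₀‖ := by rw [sub_add_cancel]
      _ ≤ _ := (norm_add_le _ _).trans (by gcongr)
  obtain ⟨B, hB⟩ := exists_weakLimit u (fun d : D => (d : H →L[ℂ] H)) _ hC
  -- The weak limit B lies below A because every d does, and it is an upper bound of D because d ≤
  -- d' eventually in d'.
  have hBA : B = A := by
    refine le_antisymm ?_ (hA.2 fun d hd => ?_)
    · rw [← sub_nonneg]
      refine ContinuousLinearMap.nonneg_of_tendsto (l := (u : Filter D)) (S := fun d : D => A - (d : H →L[ℂ] H))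
        (Eventually.of_forall fun d => sub_nonneg.2 (hA.1 d.2)) fun x => ?_
      simp only [sub_apply, inner_sub_right]
      exact tendsto_const_nhds.sub (hB x x)
    · rw [← sub_nonneg]
      refine ContinuousLinearMap.nonneg_of_tendsto (l := (u : Filter D)) (S := fun d' : D => (d' : H →L[ℂ] H) - d)
        ((hu ⟨d, hd⟩).mono fun d' h => sub_nonneg.2 h) fun x => ?_
      simp only [sub_apply, inner_sub_right]
      exact (hB x x).sub tendsto_const_nhds
  exact ⟨u, _, hC, hBA ▸ hB⟩

/-- Dominated convergence handles only countably generated limits, whereas normality concerns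
arbitrary nets. With R = |x⟩⟨x| the predual turns ⟨x, Λ(d) x⟩ into tr[T d], which is continuous
along every bounded weakly convergent net. -/
theorem isNormalMap_of_predual (hmono : Monotone Λ)
    (h : ∀ R, IsTraceClass R → ∃ T : H →L[ℂ] H, IsTraceClass T ∧
      ∀ A, opTrace (R * Λ A) = opTrace (T * A)) : IsNormalMap Λ := by
  intro D A hne hdir hA
  refine ⟨?_, fun C hC => ?_⟩
  · rintro _ ⟨d, hd, rfl⟩
    exact hmono (hA.1 hd)
  · obtain ⟨u, c, hc, hlim⟩ := exists_tendsto_of_isLUB hne hdir hA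
    rw [← sub_nonneg]
    refine ContinuousLinearMap.nonneg_of_tendsto (l := (u : Filter D)) (S := fun d : D => C - Λ d)
      (Eventually.of_forall fun d => sub_nonneg.2 (hC ⟨d, d.2, rfl⟩)) fun x => ?_
    obtain ⟨T, hT, hTA⟩ := h _ (isTraceClass_rankOne_self x)
    simp only [sub_apply, inner_sub_right]
    refine tendsto_const_nhds.sub ?_
    simp only [← opTrace_rankOne_mul, hTA]
    exact hT.tendsto_opTrace hc hlim

end Predual

/-! ### The properties of the relativisation map -/

open scoped CStarAlgebra in
theorem mainTheorem2
    {G : Type*} [Group G] [TopologicalSpace G] [IsTopologicalGroup G] [LocallyCompactSpace G]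
    [TopologicalSpace.MetrizableSpace G] [MeasurableSpace G] [BorelSpace G]
    {HS : Type*} [NormedAddCommGroup HS] [InnerProductSpace ℂ HS] [CompleteSpace HS]
    [TopologicalSpace.SeparableSpace HS]
    {HR : Type*} [NormedAddCommGroup HR] [InnerProductSpace ℂ HR] [CompleteSpace HR]
    [TopologicalSpace.SeparableSpace HR]
    (US : G →* unitary (HS →L[ℂ] HS)) (hUS : ∀ x : HS, Continuous fun g => (US g : HS →L[ℂ] HS) x)
    (UR : G →* unitary (HR →L[ℂ] HR)) (hUR : ∀ x : HR, Continuous fun g => (UR g : HR →L[ℂ] HR) x)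
    (F : POM G HR) (hF : IsCovariant UR F) :
    -- the weak integral exists on all bounded operators and is unique
    (∀ A : HS →L[ℂ] HS,
      (∃! B, IsRelativisation US F A B) ∧ IsRelativisation US F A (relativise US F A)) ∧
    -- where the action is norm continuous, meshes exist and it is the norm limit of Riemann sums
    (∀ A : HS →L[ℂ] HS, Continuous (fun g => conjAct US g A) →
      (SecondCountableTopology G → ∀ ε > 0, ∃ V, IsMesh US A ε V) ∧
      (∀ (ε : ℕ → ℝ) (V : ℕ → ℕ → Set G) (p : ℕ → ℕ → G), Tendsto ε atTop (𝓝 0) →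
        (∀ N, IsMesh US A (ε N) (V N)) → (∀ N n, (V N n).Nonempty → p N n ∈ V N n) →
        ∃ S : ℕ → HilbertTensor HS HR →L[ℂ] HilbertTensor HS HR,
          (∀ N, IsRiemannSum US F A (V N) (p N) (S N)) ∧
          Tendsto S atTop (𝓝 (relativise US F A)))) ∧
    -- it extends from such operators as a limit of sesquilinear forms
    (∀ A : HS →L[ℂ] HS, ∃ a : ℕ → HS →L[ℂ] HS,
      (∀ n, Continuous (fun g => conjAct US g (a n))) ∧ (∀ n, ‖a n‖ ≤ ‖A‖) ∧
      ∀ x y : HS, Tendsto (fun n => ⟪x, a n y⟫) atTop (𝓝 ⟪x, A y⟫)) ∧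
    (∀ (A : HS →L[ℂ] HS) (a : ℕ → HS →L[ℂ] HS) (C : ℝ), (∀ n, ‖a n‖ ≤ C) →
      (∀ x y : HS, Tendsto (fun n => ⟪x, a n y⟫) atTop (𝓝 ⟪x, A y⟫)) →
      ∀ Φ Ψ : HilbertTensor HS HR, Tendsto (fun n => ⟪Φ, relativise US F (a n) Ψ⟫) atTop
        (𝓝 ⟪Φ, relativise US F A Ψ⟫)) ∧
    -- for compact `G` and finite-dimensional `HR` it is given by an integral over Haar measure
    (CompactSpace G → FiniteDimensional ℂ HR → ∀ (μ : Measure G) [μ.IsHaarMeasure] (κ : ℝ)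
      (T : HR →L[ℂ] HR), 0 ≤ T →
      (∀ X, MeasurableSet X → ∀ η η' : HR,
        ⟪η, F X η'⟫ = κ * ∫ g in X, ⟪η, conjAct UR g T η'⟫ ∂μ) →
      ∀ (A : HS →L[ℂ] HS) (Φ Ψ : HilbertTensor HS HR),
        ⟪Φ, relativise US F A Ψ⟫ =
          κ * ∫ g, ⟪Φ, opTens (conjAct US g A) (conjAct UR g T) Ψ⟫ ∂μ) ∧
    -- linear, unital, adjoint preserving
    (∀ A B : HS →L[ℂ] HS, relativise US F (A + B) = relativise US F A + relativise US F B) ∧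
    (∀ (c : ℂ) (A : HS →L[ℂ] HS), relativise US F (c • A) = c • relativise US F A) ∧
    relativise US F 1 = 1 ∧
    (∀ A : HS →L[ℂ] HS, relativise US F (star A) = star (relativise US F A)) ∧
    -- positive and bounded
    (∀ A : HS →L[ℂ] HS, 0 ≤ A → 0 ≤ relativise US F A) ∧
    (∀ A : HS →L[ℂ] HS, ‖relativise US F A‖ ≤ ‖A‖) ∧
    -- completely positive
    (∃ Λ : (HS →L[ℂ] HS) →CP (HilbertTensor HS HR →L[ℂ] HilbertTensor HS HR),
      ∀ A, Λ A = relativise US F A) ∧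
    -- the dual of a bounded linear map between the trace classes
    (∃ P : (HilbertTensor HS HR →L[ℂ] HilbertTensor HS HR) → (HS →L[ℂ] HS),
      (∀ R, IsTraceClass R → IsTraceClass (P R)) ∧
      (∀ R R', IsTraceClass R → IsTraceClass R' → P (R + R') = P R + P R') ∧
      (∀ (c : ℂ) (R), IsTraceClass R → P (c • R) = c • P R) ∧
      (∃ C : ℝ, ∀ R, IsTraceClass R → traceNorm (P R) ≤ C * traceNorm R) ∧
      (∀ R, IsTraceClass R → ∀ A : HS →L[ℂ] HS,
        opTrace (R * relativise US F A) = opTrace (P R * A)) ∧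
      (∀ R, IsTraceClass R → ∀ S : HS →L[ℂ] HS, IsTraceClass S →
        (∀ A : HS →L[ℂ] HS, opTrace (R * relativise US F A) = opTrace (S * A)) → S = P R)) ∧
    -- normal
    IsNormalMap (relativise US F) ∧
    -- effects go to effects and POMs go to POMs
    (∀ E : HS →L[ℂ] HS, 0 ≤ E → E ≤ 1 → 0 ≤ relativise US F E ∧ relativise US F E ≤ 1) ∧
    (∀ {Ω : Type*} [MeasurableSpace Ω] (E : POM Ω HS),
      ∃ E' : POM Ω (HilbertTensor HS HR), ∀ X, E' X = relativise US F (E X)) ∧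
    -- a *-homomorphism if `F` is projection valued
    (F.IsProjectionValued →
      (∀ A B : HS →L[ℂ] HS, relativise US F (A * B) = relativise US F A * relativise US F B) ∧
      ∃ Λ : (HS →L[ℂ] HS) →⋆ₐ[ℂ] (HilbertTensor HS HR →L[ℂ] HilbertTensor HS HR),
        ∀ A, Λ A = relativise US F A) ∧
    -- invariance of the range, and the values at invariant operators
    (∀ (g : G) (A : HS →L[ℂ] HS),
      opTens (US g : HS →L[ℂ] HS) (UR g : HR →L[ℂ] HR) * relativise US F A *
        star (opTens (US g : HS →L[ℂ] HS) (UR g : HR →L[ℂ] HR)) = relativise US F A) ∧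
    (∀ A : HS →L[ℂ] HS, (∀ g : G, conjAct US g A = A) → relativise US F A = opTens A 1) := by
  have hw : ∀ (A : HS →L[ℂ] HS) (a : ℕ → HS →L[ℂ] HS), (∀ n, ‖a n‖ ≤ ‖A‖) →
      (∀ x y, Tendsto (fun n => ⟪x, a n y⟫) atTop (𝓝 ⟪x, A y⟫)) → ∀ x y, Tendsto
        (fun n => ⟪x, relativiseLinear hUS F (a n) y⟫) atTop (𝓝 ⟪x, relativiseLinear hUS F A y⟫) :=
    fun _ _ hC h => tendsto_relativise hUS F hC h
  have hnorm : ∀ A, ‖relativiseLinear hUS F A‖ ≤ ‖A‖ := norm_relativise_le hUS F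
  refine ⟨?_, ?_, ?_, ?_, ?_, relativise_add hUS F, relativise_smul hUS F, relativise_one US F,
    relativise_star hUS F, ?_, norm_relativise_le hUS F, ?_, ?_, ?_, ?_, ?_, ?_, ?_, ?_⟩
  · intro A
    have h := isRelativisation_relativise hUS F A
    exact ⟨⟨_, h, fun B hB => IsWeakIntegral.unique hB h⟩, h⟩
  · intro A hA
    exact ⟨fun _ ε hε => exists_isMesh hA hε,
      fun ε V p hε hV hp => exists_tendsto_riemannSums hUS F hε hV hp⟩
  · intro A
    obtain ⟨a, ha, hbd, hlim⟩ := exists_tendsto_finiteRankOperators A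
    exact ⟨a, fun n => continuous_conjAct_of_mem_finiteRankOperators hUS (ha n), hbd, hlim⟩
  · intro A a C hC h
    exact tendsto_relativise hUS F hC h
  · intro _ _ μ _ κ T hT h A Φ Ψ
    exact inner_relativise_eq_integral hUS hUR F μ κ hT h A Φ Ψ
  · exact fun A => relativise_nonneg hUS F
  · exact exists_completelyPositiveMap_relativise hUS F
  · have h := exists_predual hnorm hw
    simp only [relativiseLinear_apply] at h
    exact h
  · refine isNormalMap_of_predual (Λ := relativiseLinear hUS F)
      (fun A B h => relativise_mono hUS F h) fun R hR => ?_
    obtain ⟨T, h1, -, h2⟩ := exists_predual_apply hnorm hw hR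
    exact ⟨T, h1, h2⟩
  · intro E h0 h1
    exact ⟨relativise_nonneg hUS F h0, (relativise_mono hUS F h1).trans_eq (relativise_one US F)⟩
  · intro Ω _ E
    exact exists_pom_relativise hUS F E
  · exact fun h => ⟨relativise_mul hUS h, exists_starAlgHom_relativise hUS h⟩
  · exact fun g A => isCovariant_relativise hUS F hF g A
  · exact fun A hA => relativise_of_invariant US F hA
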